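/- Let $T>0$, $d\ge 0$ an integer, $S^1=\mathbf R/\mathbf Z$ identified with $[0,1]$, and let $\tilde p_t(x)=\sum_{n\in\mathbf Z}(4\pi t)^{-1/2}e^{-(x+n)^2/(4t)}$ be the heat kernel of $S^1$. Let $\xi^1,\dots,\xi^d$ be independent space-time white noises on $[0,T]\times S^1$ and let $\psi=(\psi(t,x))_{0\le t\le T,\,0\le x\le 1}$ be the solution of the $\mathbf R^d$-valued stochastic heat equation $\partial_t\psi=\partial_x^2\psi+\xi$, $\psi(0,\cdot)\equiv 0$, that is, $\psi^i(t,x)=\int_0^t\int_0^1\tilde p_{t-s}(x-y)\,\xi^i(ds,dy)$ for $1\le i\le d$. For a Banach space $\mathcal V$, $S>0$, $\gamma\in(0,1]$ and real $m\ge 1$, let $C^{B;\gamma,m}([0,S],\mathcal V)$ be the space of continuous $f:[0,S]\to\mathcal V$ with $\|f\|=|f_0|+\bigl(\iint_{0\le s\le t\le S}|f_t-f_s|^m|t-s|^{-1-\gamma m}\,ds\,dt\bigr)^{1/m}<\infty$, and let $C_0^{B;\gamma,m}$ be its subspace of paths with $f_0=0$. Let $\alpha\in(1/3,1/2)$, $\beta>0$,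 $m\ge1$ satisfy $\alpha-1/m>1/3$, $\beta>1/m$, $4\beta<1-2\alpha$. Let $\mu$ be the law of $\psi$, a centred Gaussian measure on $E=C_0^{B;\beta,m}\bigl([0,T],C^{B;\alpha,m}([0,1],\mathbf R^d)\bigr)$, and let $\mathcal H$ be its Cameron–Martin space, $\|h\|_{\mathcal H}=\sup\{\ell(h):\ell\in E^*,\ \mathrm{Var}_\mu(\ell)\le 1\}$, $\mathcal H=\{h\in E:\|h\|_{\mathcal H}<\infty\}$. (i) There is a constant $c=c_T>0$ such that for all $h\in\mathcal H$ and all $t\in[0,T]$ the path $h(t,\cdot)$ is $1/2$-Hölder continuous and $$|h(t,0)|+\sup_{0\le x<y\le1}\frac{|h(t,y)-h(t,x)|}{|y-x|^{1/2}}\le c\,\|h\|_{\mathcal H}.$$ (ii) For every $q\in(4/3,2)$ there is a constant $c=c_{T,q}>0$ such that for all $h\in\mathcal H$ and all $t\in[0,T]$ the path $h(t,\cdot)$ has finite $q$-variation and $$\Bigl(\sup_{0\le x_0\le\dots\le x_n\le1}\ \sum_{i=1}^{n}|h(t,x_i)-h(t,x_{i-1})|^q\Bigr)^{1/q}\le c\,\|h\|_{\mathcal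 H}.$$ The constants depend only on $T$, respectively on $T$ and $q$. -/

import Mathlib

open MeasureTheory ProbabilityTheory
open scoped ENNReal NNReal

noncomputable section

/-! ### Besov path spaces -/

namespace BesovPath

/-- Lebesgue measure on `[0, T]`, as a measure on the subtype. -/
def timeMeasure (T : ℝ) : Measure (Set.Icc (0 : ℝ) T) := volume.comap Subtype.val

instance (T : ℝ) : IsFiniteMeasure (timeMeasure T) := by
  refine ⟨?_⟩
  rw [timeMeasure, comap_subtype_coe_apply measurableSet_Icc, Set.image_univ, Subtype.range_coe]
  exact measure_Icc_lt_top

/-- The Besov seminorm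
`(∬_{0 ≤ s ≤ t ≤ T} |f_t - f_s|^m / |t - s|^(1 + α m) ds dt)^(1/m)` of a continuous path. -/
def seminorm {T : ℝ} (α m : ℝ) {V : Type*} [NormedAddCommGroup V]
    (f : C(Set.Icc (0 : ℝ) T, V)) : ℝ≥0∞ :=
  (∫⁻ p in {p : Set.Icc (0 : ℝ) T × Set.Icc (0 : ℝ) T | p.1 ≤ p.2},
    ‖f p.2 - f p.1‖ₑ ^ m / ENNReal.ofReal (|(p.2 : ℝ) - (p.1 : ℝ)| ^ (1 + α * m))
      ∂((timeMeasure T).prod (timeMeasure T))) ^ (1 / m)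

section Lemmas

variable {T : ℝ} {α m : ℝ} {V : Type*} [NormedAddCommGroup V]

/-- The quotient whose `L^m` norm over the simplex is the Besov seminorm. -/
def quot (α m : ℝ) (f : C(Set.Icc (0 : ℝ) T, V))
    (p : Set.Icc (0 : ℝ) T × Set.Icc (0 : ℝ) T) : ℝ≥0∞ :=
  ‖f p.2 - f p.1‖ₑ / ENNReal.ofReal (|(p.2 : ℝ) - (p.1 : ℝ)| ^ (1 + α * m)) ^ (1 / m)

lemma measurable_quot (f : C(Set.Icc (0 : ℝ) T, V)) : Measurable (quot α m f) := by
  unfold quot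
  refine Measurable.div (Continuous.measurable (by fun_prop)) ?_
  refine Measurable.pow_const (Measurable.ennreal_ofReal (Measurable.pow_const ?_ _)) _
  exact Continuous.measurable (by fun_prop)

lemma seminorm_eq (hm : 1 ≤ m) (f : C(Set.Icc (0 : ℝ) T, V)) :
    seminorm α m f =
      (∫⁻ p in {p : Set.Icc (0 : ℝ) T × Set.Icc (0 : ℝ) T | p.1 ≤ p.2},
        quot α m f p ^ m ∂((timeMeasure T).prod (timeMeasure T))) ^ (1 / m) := by
  have hm0 : 0 < m := by linarith
  unfold seminorm quot
  congr 2
  funext p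
  rw [ENNReal.div_rpow_of_nonneg _ _ hm0.le, ← ENNReal.rpow_mul, one_div,
    inv_mul_cancel₀ hm0.ne', ENNReal.rpow_one]

lemma seminorm_zero (hm : 1 ≤ m) : seminorm α m (0 : C(Set.Icc (0 : ℝ) T, V)) = 0 := by
  have hm0 : 0 < m := by linarith
  simp [seminorm, hm0]

lemma seminorm_add_le (hm : 1 ≤ m) (f g : C(Set.Icc (0 : ℝ) T, V)) :
    seminorm α m (f + g) ≤ seminorm α m f + seminorm α m g := by
  have hm0 : 0 < m := by linarith
  rw [seminorm_eq hm, seminorm_eq hm, seminorm_eq hm]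
  refine le_trans ?_ (ENNReal.lintegral_Lp_add_le (measurable_quot f).aemeasurable
    (measurable_quot g).aemeasurable hm)
  refine ENNReal.rpow_le_rpow (lintegral_mono fun p => ?_) (by positivity)
  refine ENNReal.rpow_le_rpow ?_ hm0.le
  simp only [quot, Pi.add_apply, ContinuousMap.add_apply]
  rw [← ENNReal.add_div]
  gcongr
  rw [add_sub_add_comm]
  exact enorm_add_le _ _

lemma seminorm_smul [NormedSpace ℝ V] (hm : 1 ≤ m) (c : ℝ) (f : C(Set.Icc (0 : ℝ) T, V)) :
    seminorm α m (c • f) = ‖c‖ₑ * seminorm α m f := by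
  have hm0 : 0 < m := by linarith
  have key : ∀ p, quot α m (c • f) p ^ m = ‖c‖ₑ ^ m * quot α m f p ^ m := fun p => by
    rw [← ENNReal.mul_rpow_of_nonneg _ _ hm0.le]
    simp only [quot, ContinuousMap.smul_apply, ← smul_sub, enorm_smul, mul_div_assoc]
  rw [seminorm_eq hm, seminorm_eq hm]
  simp_rw [key]
  rw [lintegral_const_mul _ ((measurable_quot f).pow_const m),
    ENNReal.mul_rpow_of_nonneg _ _ (by positivity), ← ENNReal.rpow_mul, mul_one_div,
    div_self hm0.ne', ENNReal.rpow_one]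

lemma isOpenPosMeasure (hT : 0 < T) :
    (timeMeasure T).IsOpenPosMeasure := by
  refine ⟨fun U hU ⟨x, hx⟩ => ?_⟩
  obtain ⟨O, hO, rfl⟩ := isOpen_induced_iff.1 hU
  rw [timeMeasure, comap_subtype_coe_apply measurableSet_Icc, Subtype.image_preimage_coe]
  have hcl : (x : ℝ) ∈ closure (Set.Ioo (0 : ℝ) T) := by
    rw [closure_Ioo hT.ne]; exact x.2
  obtain ⟨y, hyO, hyI⟩ := mem_closure_iff.1 hcl O hO hx
  refine ne_of_gt (lt_of_lt_of_le ((hO.inter isOpen_Ioo).measure_pos volume ⟨y, hyO, hyI⟩)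
    (measure_mono ?_))
  exact fun z hz => ⟨Set.Ioo_subset_Icc_self hz.2, hz.1⟩

/-- A path with vanishing Besov seminorm is constant. -/
lemma eq_of_seminorm_eq_zero (hT : 0 < T) (hm : 1 ≤ m) (f : C(Set.Icc (0 : ℝ) T, V))
    (h : seminorm α m f = 0) (t : Set.Icc (0 : ℝ) T) : f t = f ⟨0, le_rfl, hT.le⟩ := by
  have hm0 : 0 < m := by linarith
  have := isOpenPosMeasure hT
  rw [seminorm_eq hm, ENNReal.rpow_eq_zero_iff_of_pos (by positivity),
    lintegral_eq_zero_iff ((measurable_quot f).pow_const m)] at h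
  have hopen : IsOpen {p : Set.Icc (0 : ℝ) T × Set.Icc (0 : ℝ) T | p.1 < p.2} :=
    isOpen_lt continuous_fst continuous_snd
  have h' := ae_restrict_of_ae_restrict_of_subset
    (s := {p : Set.Icc (0 : ℝ) T × Set.Icc (0 : ℝ) T | p.1 < p.2})
    (fun p (hp : p.1 < p.2) => hp.le) h
  have h2 : (fun p : Set.Icc (0 : ℝ) T × Set.Icc (0 : ℝ) T => ‖f p.2 - f p.1‖)
      =ᵐ[((timeMeasure T).prod (timeMeasure T)).restrict {p | p.1 < p.2}] fun _ => 0 := by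
    filter_upwards [h'] with p hp
    have hq : quot α m f p = 0 := by
      simpa [ENNReal.rpow_eq_zero_iff_of_pos hm0] using hp
    have h3 := (ENNReal.div_eq_zero_iff.1 hq).resolve_right
      (ENNReal.rpow_ne_top_of_nonneg (by positivity) ENNReal.ofReal_ne_top)
    simpa using h3
  have h4 := Measure.eqOn_open_of_ae_eq h2 hopen (Continuous.continuousOn (by fun_prop))
    continuousOn_const
  rcases t.2.1.eq_or_lt with h0 | h0
  · congr 1; exact Subtype.ext h0.symm
  · have h5 := h4 (x := (⟨0, le_rfl, hT.le⟩, t)) (by exact h0)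
    exact sub_eq_zero.1 (norm_eq_zero.1 h5)

end Lemmas

/-- The subspace of continuous paths with finite Besov seminorm. -/
def submodule (T α m : ℝ) [hm : Fact (1 ≤ m)] (V : Type*) [NormedAddCommGroup V]
    [NormedSpace ℝ V] : Submodule ℝ C(Set.Icc (0 : ℝ) T, V) where
  carrier := {f | seminorm α m f < ∞}
  add_mem' hf hg := (seminorm_add_le hm.out _ _).trans_lt (ENNReal.add_lt_top.2 ⟨hf, hg⟩)
  zero_mem' := by simp [seminorm_zero hm.out]
  smul_mem' c f hf := by
    simp only [Set.mem_ofPred_eq, seminorm_smul hm.out] at hf ⊢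
    exact ENNReal.mul_lt_top enorm_lt_top hf

end BesovPath

/-- The space `C^{B; α, m}([0, T], V)` of continuous paths with finite `(α, m)`-Besov norm
`‖f‖ = |f_0| + (∬_{0 ≤ s ≤ t ≤ T} |f_t - f_s|^m / |t - s|^(1 + α m) ds dt)^(1/m)`. -/
def BesovPath (T α m : ℝ) [Fact (1 ≤ m)] (V : Type*) [NormedAddCommGroup V]
    [NormedSpace ℝ V] : Type _ :=
  BesovPath.submodule T α m V

namespace BesovPath

variable {T α m : ℝ} [hm : Fact (1 ≤ m)] {V : Type*} [NormedAddCommGroup V] [NormedSpace ℝ V]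

instance : AddCommGroup (BesovPath T α m V) :=
  inferInstanceAs (AddCommGroup (BesovPath.submodule T α m V))

instance : Module ℝ (BesovPath T α m V) :=
  inferInstanceAs (Module ℝ (BesovPath.submodule T α m V))

/-- The underlying continuous path. -/
def toContinuousMap (f : BesovPath T α m V) : C(Set.Icc (0 : ℝ) T, V) := f.1

instance : CoeFun (BesovPath T α m V) fun _ => Set.Icc (0 : ℝ) T → V :=
  ⟨fun f => f.toContinuousMap⟩

variable [hT : Fact (0 < T)]

/-- The initial time `0`. -/
def start (T : ℝ) [hT : Fact (0 < T)] : Set.Icc (0 : ℝ) T := ⟨0, le_rfl, hT.out.le⟩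

instance : Norm (BesovPath T α m V) where
  norm f := ‖f (start T)‖ + (seminorm α m f.toContinuousMap).toReal

lemma norm_def (f : BesovPath T α m V) :
    ‖f‖ = ‖f (start T)‖ + (seminorm α m f.toContinuousMap).toReal := rfl

lemma core : NormedSpace.Core ℝ (BesovPath T α m V) where
  norm_nonneg f := by rw [norm_def]; positivity
  norm_smul c f := by
    rw [norm_def, norm_def]
    have h1 : (c • f).toContinuousMap = c • f.toContinuousMap := rfl
    rw [h1, seminorm_smul hm.out, ENNReal.toReal_mul, ContinuousMap.smul_apply, norm_smul]
    simp [mul_add]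
  norm_triangle f g := by
    rw [norm_def, norm_def, norm_def]
    have h1 : (f + g).toContinuousMap = f.toContinuousMap + g.toContinuousMap := rfl
    have h2 := ENNReal.toReal_mono (ENNReal.add_lt_top.2 ⟨f.2, g.2⟩).ne
      (seminorm_add_le (α := α) hm.out f.toContinuousMap g.toContinuousMap)
    rw [ENNReal.toReal_add (ne_of_lt f.2) (ne_of_lt g.2)] at h2
    have h3 := norm_add_le (f (start T)) (g (start T))
    rw [h1, ContinuousMap.add_apply]
    linarith!
  norm_eq_zero_iff f := by
    constructor
    · intro h
      rw [norm_def] at h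
      have h1 : ‖f (start T)‖ = 0 := le_antisymm
        (by linarith [ENNReal.toReal_nonneg (a := seminorm α m f.toContinuousMap)])
        (norm_nonneg _)
      have h2 : (seminorm α m f.toContinuousMap).toReal = 0 := by linarith
      have h3 := ((ENNReal.toReal_eq_zero_iff _).1 h2).resolve_right (ne_of_lt f.2)
      refine Subtype.ext (ContinuousMap.ext fun t => ?_)
      exact (eq_of_seminorm_eq_zero hT.out hm.out f.toContinuousMap h3 t).trans
        (norm_eq_zero.1 h1)
    · rintro rfl
      have h0 : (0 : BesovPath T α m V).toContinuousMap = 0 := rfl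
      rw [norm_def, h0, seminorm_zero hm.out]
      simp

instance : NormedAddCommGroup (BesovPath T α m V) := NormedAddCommGroup.ofCore core

instance : NormedSpace ℝ (BesovPath T α m V) := NormedSpace.ofCore core

instance : MeasurableSpace (BesovPath T α m V) := borel _

instance : BorelSpace (BesovPath T α m V) := ⟨rfl⟩

variable (T α m V) in
/-- The subspace `C_0^{B; α, m}([0, T], V)` of Besov paths that start at `0`, with the Besov
norm. -/
def startZero : Submodule ℝ (BesovPath T α m V) where
  carrier := {f | f (start T) = 0}
  add_mem' {f g} hf hg := by
    have h1 : (f + g).toContinuousMap = f.toContinuousMap + g.toContinuousMap := rfl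
    simp only [Set.mem_ofPred_eq] at hf hg ⊢
    rw [h1, ContinuousMap.add_apply, hf, hg, add_zero]
  zero_mem' := rfl
  smul_mem' c f hf := by
    have h1 : (c • f).toContinuousMap = c • f.toContinuousMap := rfl
    simp only [Set.mem_ofPred_eq] at hf ⊢
    rw [h1, ContinuousMap.smul_apply, hf, smul_zero]

end BesovPath

instance factZeroLtOne : Fact ((0 : ℝ) < 1) := ⟨one_pos⟩

/-- The space `C_0^{B; β, m}([0, T], C^{B; α, m}([0, 1], ℝ^d))` of sheets `(t, x) ↦ f(t, x)`,
a normed space with its Borel `σ`-algebra. -/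
abbrev SheetSpace (T α β m : ℝ) [Fact (0 < T)] [Fact (1 ≤ m)] (d : ℕ) : Type :=
  BesovPath.startZero T β m (BesovPath 1 α m (EuclideanSpace ℝ (Fin d)))

/-- The path `x ↦ f(t, x)`. -/
def SheetSpace.slice {T α β m : ℝ} [Fact (0 < T)] [Fact (1 ≤ m)] {d : ℕ}
    (f : SheetSpace T α β m d) (t : Set.Icc (0 : ℝ) T) :
    Set.Icc (0 : ℝ) 1 → EuclideanSpace ℝ (Fin d) :=
  (f : BesovPath T β m (BesovPath 1 α m (EuclideanSpace ℝ (Fin d)))) t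

/-! ### The stochastic heat equation on the circle -/

/-- The heat kernel `p_t(x)` of `∂_t - ∂_x²` on `ℝ`. -/
def heatKernel (t x : ℝ) : ℝ := 1 / √(4 * Real.pi * t) * Real.exp (-(x ^ 2) / (4 * t))

/-- The heat kernel of the circle `ℝ/ℤ`, as a `1`-periodic function. -/
def periodicHeatKernel (t x : ℝ) : ℝ := ∑' n : ℤ, heatKernel t (x + n)

/-- Lebesgue measure on `[0, T] × S¹`, the circle being identified with `[0, 1]`. -/
def spaceTimeMeasure (T : ℝ) : Measure (ℝ × ℝ) :=
  (volume.restrict (Set.Icc 0 T)).prod (volume.restrict (Set.Icc 0 1))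

/-- The integrand `(s, y) ↦ 1_{s < t} p̃_{t-s}(x - y)` of the stochastic convolution. -/
def duhamelKernel (t x : ℝ) (p : ℝ × ℝ) : ℝ :=
  if p.1 < t then periodicHeatKernel (t - p.1) (x - p.2) else 0

/-- A space-time white noise on `[0, T] × S¹` over `(Ω, P)`: a linear map `f ↦ ξ(f)` from
`L²([0, T] × S¹)` to `L²(P)` such that `ξ(f)` is centred Gaussian with variance `‖f‖²`. -/
def IsWhiteNoise {Ω : Type*} [MeasurableSpace Ω] (T : ℝ) (P : Measure Ω)
    (ξ : Lp ℝ 2 (spaceTimeMeasure T) →ₗ[ℝ] Lp ℝ 2 P) : Prop :=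
  ∀ f : Lp ℝ 2 (spaceTimeMeasure T), HasLaw (ξ f) (gaussianReal 0 (‖f‖₊ ^ 2)) P

/-- `ψ` is (a version with values in the sheet space of) the mild solution
`ψ^i(t, x) = ∫_0^t ∫_{S¹} p̃_{t-s}(x - y) ξ^i(ds, dy)` of the `ℝ^d`-valued stochastic heat equation
`∂_t ψ = Δ ψ + ξ`, `ψ(0, ·) = 0`, driven by independent white noises `ξ^1, …, ξ^d`. -/
structure IsStochasticHeatSheet {Ω : Type*} [MeasurableSpace Ω] {T α β m : ℝ} [Fact (0 < T)]
    [Fact (1 ≤ m)] {d : ℕ} (P : Measure Ω)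
    (ξ : Fin d → Lp ℝ 2 (spaceTimeMeasure T) →ₗ[ℝ] Lp ℝ 2 P)
    (ψ : Ω → SheetSpace T α β m d) : Prop where
  isWhiteNoise : ∀ i, IsWhiteNoise T P (ξ i)
  indep : iIndepFun (fun i ω (f : Lp ℝ 2 (spaceTimeMeasure T)) => ξ i f ω) P
  aemeasurable : AEMeasurable ψ P
  mild : ∀ (t : Set.Icc (0 : ℝ) T) (x : Set.Icc (0 : ℝ) 1) (i : Fin d),
    ∃ hK : MemLp (duhamelKernel t x) 2 (spaceTimeMeasure T),
      (fun ω => (ψ ω).slice t x i) =ᵐ[P] ξ i (hK.toLp _)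

/-! ### Cameron–Martin space, Hölder norm and variation norm -/

/-- The Cameron–Martin norm `sup {ℓ(h) | ℓ ∈ E', Var_μ(ℓ) ≤ 1}` of `h ∈ E` for a Gaussian
measure `μ` on a normed space `E`. -/
def cameronMartinNorm {E : Type*} [NormedAddCommGroup E] [NormedSpace ℝ E] [MeasurableSpace E]
    (μ : Measure E) (h : E) : ℝ≥0∞ :=
  ⨆ (ℓ : StrongDual ℝ E) (_ : evariance ℓ μ ≤ 1), ENNReal.ofReal (ℓ h)

/-- The Cameron–Martin space of a Gaussian measure: the vectors of finite Cameron–Martin norm. -/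
def cameronMartinSpace {E : Type*} [NormedAddCommGroup E] [NormedSpace ℝ E] [MeasurableSpace E]
    (μ : Measure E) : Set E :=
  {h | cameronMartinNorm μ h < ∞}

/-- The `α`-Hölder norm `|f(0)| + sup_{x < y} |f(y) - f(x)| / |y - x|^α` of a path on `[0, 1]`. -/
def holderNorm {V : Type*} [NormedAddCommGroup V] (α : ℝ) (f : Set.Icc (0 : ℝ) 1 → V) : ℝ≥0∞ :=
  ‖f 0‖ₑ + ⨆ (x : Set.Icc (0 : ℝ) 1) (y : Set.Icc (0 : ℝ) 1) (_ : x < y),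
    ‖f y - f x‖ₑ / ENNReal.ofReal (|(y : ℝ) - (x : ℝ)| ^ α)

/-- The `q`-variation norm `(sup ∑ |f(x_{i+1}) - f(x_i)|^q)^(1/q)` of a path on `[0, 1]`, the
supremum being over all finite increasing sequences of points of `[0, 1]`. -/
def variationNorm {V : Type*} [NormedAddCommGroup V] (q : ℝ) (f : Set.Icc (0 : ℝ) 1 → V) :
    ℝ≥0∞ :=
  (⨆ p : ℕ × {u : ℕ → Set.Icc (0 : ℝ) 1 // Monotone u},
    ∑ i ∈ Finset.range p.1, ‖f (p.2.1 (i + 1)) - f (p.2.1 i)‖ₑ ^ q) ^ (1 / q)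

end

/-!
By definition of the Cameron–Martin norm, `ℓ(h) ≤ √Var(ℓ) ‖h‖` for every continuous functional
`ℓ`. For a linear combination `ℓ` of evaluations at `(t, x_j)` the variance is the squared
`L²`-norm of the same combination of the kernels `p̃_{t-s}(x_j - y)`. By Parseval on the circle it
is a sum over Fourier modes; integrating `e^{-8π²n²(t-s)}` over `s` gives the mode `n ≠ 0`
the weight `(1 - e^{-8π²n²t}) / (8π²n²)`. A combination of increments has no mode `n = 0`, and its
coefficients are `2πin` times those of a step function, so its variance is at most half the squared
`L²`-norm of that function. Choosing the weights of the increments to be unit vectors pointing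
along the increments of `h(t, ·)` bounds the total variation of `h(t, ·)` on `[x, y]` by
`√((y - x) / 2) ‖h‖`, which yields both the Hölder bound and the `q`-variation bound.
-/

noncomputable section

section Averages

variable {X : Type*} [MeasurableSpace X] {V : Type*} [PseudoEMetricSpace V]

lemma lintegral_le_rpow_lintegral_rpow (P : Measure X) [IsProbabilityMeasure P] {f : X → ℝ≥0∞}
    (hf : AEMeasurable f P) {m : ℝ} (hm : 1 ≤ m) :
    ∫⁻ x, f x ∂P ≤ (∫⁻ x, f x ^ m ∂P) ^ (1 / m) := by
  simpa [eLpNorm'] using eLpNorm'_le_eLpNorm'_of_exponent_le one_pos hm P hf.aestronglyMeasurable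

lemma lintegral_edist_le_add_lintegral_prod (P Q : Measure X) [IsProbabilityMeasure P]
    [IsProbabilityMeasure Q] {f : X → V} (hf : StronglyMeasurable f) (v : V) :
    ∫⁻ s, edist v (f s) ∂P ≤
      ∫⁻ r, edist v (f r) ∂Q + ∫⁻ p, edist (f p.1) (f p.2) ∂Q.prod P := by
  have hv : Measurable fun r => edist v (f r) := (stronglyMeasurable_const.edist hf).measurable
  have hff : Measurable fun p : X × X => edist (f p.1) (f p.2) :=
    ((hf.comp_measurable measurable_fst).edist (hf.comp_measurable measurable_snd)).measurable
  calc ∫⁻ s, edist v (f s) ∂P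
      = ∫⁻ _, ∫⁻ s, edist v (f s) ∂P ∂Q := by simp
    _ ≤ ∫⁻ r, ∫⁻ s, edist v (f r) + edist (f r) (f s) ∂P ∂Q := by
      gcongr
      exact edist_triangle _ _ _
    _ = ∫⁻ r, edist v (f r) ∂Q + ∫⁻ p, edist (f p.1) (f p.2) ∂Q.prod P := by
      simp only [lintegral_add_left measurable_const, lintegral_const, measure_univ, mul_one]
      rw [lintegral_add_left hv, lintegral_prod _ hff.aemeasurable]

lemma cond_le_two_smul_cond (μ : Measure X) {I J : Set X} (hJI : J ⊆ I) (hμ : μ I ≤ 2 * μ J) :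
    μ[|J] ≤ (2 : ℝ≥0∞) • μ[|I] := by
  have hinv : (μ J)⁻¹ ≤ 2 * (μ I)⁻¹ := by
    calc (μ J)⁻¹ = 2 * (2 * μ J)⁻¹ := by
          rw [ENNReal.mul_inv (by simp) (by simp), ← mul_assoc,
            ENNReal.mul_inv_cancel (by simp) (by simp), one_mul]
      _ ≤ 2 * (μ I)⁻¹ := by gcongr
  rw [ProbabilityTheory.cond, ProbabilityTheory.cond, smul_smul]
  exact Measure.le_iff'.2 fun s => mul_le_mul' hinv (Measure.restrict_mono_set μ hJI s)

lemma lintegral_edist_cond_le (μ : Measure X) [IsFiniteMeasure μ] {I J : Set X} (hJI : J ⊆ I)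
    (hI : μ I ≠ 0) (hμ : μ I ≤ 2 * μ J) {f : X → V} (hf : StronglyMeasurable f) (v : V) :
    ∫⁻ s, edist v (f s) ∂μ[|I] ≤
      ∫⁻ s, edist v (f s) ∂μ[|J] + 2 * ∫⁻ p, edist (f p.1) (f p.2) ∂(μ[|I]).prod μ[|I] := by
  have hJ : μ J ≠ 0 := fun h => hI (by simpa [h] using hμ)
  have := cond_isProbabilityMeasure hI
  have := cond_isProbabilityMeasure hJ
  refine (lintegral_edist_le_add_lintegral_prod μ[|I] μ[|J] hf v).trans ?_
  gcongr
  calc ∫⁻ p, edist (f p.1) (f p.2) ∂(μ[|J]).prod μ[|I]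
      ≤ ∫⁻ p, edist (f p.1) (f p.2) ∂((2 : ℝ≥0∞) • μ[|I]).prod μ[|I] :=
        lintegral_mono' (Measure.prod_mono (cond_le_two_smul_cond μ hJI hμ) le_rfl) le_rfl
    _ = 2 * ∫⁻ p, edist (f p.1) (f p.2) ∂(μ[|I]).prod μ[|I] := by
        rw [Measure.prod_smul_left, lintegral_smul_measure, smul_eq_mul]

lemma tendsto_lintegral_edist_of_ae_mem [TopologicalSpace X] {ι : Type*} {l : Filter ι}
    {P : ι → Measure X} [∀ n, IsProbabilityMeasure (P n)] {t : X}
    (hP : ∀ U ∈ nhds t, ∀ᶠ n in l, ∀ᵐ s ∂P n, s ∈ U) {f : X → V} (hf : ContinuousAt f t) :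
    Filter.Tendsto (fun n => ∫⁻ s, edist (f t) (f s) ∂P n) l (nhds 0) := by
  refine ENNReal.tendsto_nhds_zero.2 fun ε hε => ?_
  filter_upwards [hP _ (hf (Metric.closedEBall_mem_nhds (f t) hε))] with n hn
  calc ∫⁻ s, edist (f t) (f s) ∂P n
      ≤ ∫⁻ _, ε ∂P n := lintegral_mono_ae (hn.mono fun s hs => by
        simpa [edist_comm] using hs)
    _ = ε := by simp

lemma le_tsum_of_le_add_of_tendsto_zero {a b : ℕ → ℝ≥0∞} (hab : ∀ n, a n ≤ a (n + 1) + b n)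
    (ha : Filter.Tendsto a Filter.atTop (nhds 0)) : a 0 ≤ ∑' n, b n := by
  have hpartial (n : ℕ) : a 0 ≤ a n + ∑ k ∈ Finset.range n, b k := by
    induction n with
    | zero => simp
    | succ n ih =>
      calc a 0 ≤ a n + ∑ k ∈ Finset.range n, b k := ih
        _ ≤ a (n + 1) + b n + ∑ k ∈ Finset.range n, b k := by grw [hab n]
        _ = a (n + 1) + ∑ k ∈ Finset.range (n + 1), b k := by
          rw [Finset.sum_range_succ]; ring
  have hlim := ha.add_const (∑' n, b n)
  rw [zero_add] at hlim
  exact ge_of_tendsto' hlim fun n => (hpartial n).trans (by gcongr; exact ENNReal.sum_le_tsum _)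

end Averages

namespace BesovPath

section Embedding

variable {T β m : ℝ} {V : Type*} [NormedAddCommGroup V]

lemma timeMeasure_preimage_Icc {a b : ℝ} (ha : 0 ≤ a) (hb : b ≤ T) :
    timeMeasure T (Subtype.val ⁻¹' Set.Icc a b) = ENNReal.ofReal (b - a) := by
  rw [timeMeasure, comap_subtype_coe_apply measurableSet_Icc, Subtype.image_preimage_coe,
    Set.inter_eq_right.2 (Set.Icc_subset_Icc ha hb), Real.volume_Icc]

lemma setLIntegral_edist_rpow_inter_simplex_le (hm : 0 < m) (hβ : 0 ≤ β)
    (f : C(Set.Icc (0 : ℝ) T, V)) {I : Set (Set.Icc (0 : ℝ) T)} (hI : MeasurableSet I) {L : ℝ}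
    (hL : ∀ r ∈ I, ∀ s ∈ I, |(s : ℝ) - r| ≤ L) :
    ∫⁻ p in I ×ˢ I ∩ {p | p.1 ≤ p.2}, edist (f p.1) (f p.2) ^ m
        ∂((timeMeasure T).prod (timeMeasure T)) ≤
      ENNReal.ofReal (L ^ (1 + β * m)) * seminorm β m f ^ m := by
  rw [seminorm, ← ENNReal.rpow_mul, one_div_mul_cancel hm.ne', ENNReal.rpow_one,
    ← lintegral_const_mul' _ _ ENNReal.ofReal_ne_top]
  refine (setLIntegral_mono' ?_ fun p hp => ?_).trans (lintegral_mono_set Set.inter_subset_right)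
  · exact (hI.prod hI).inter (isClosed_le continuous_fst continuous_snd).measurableSet
  rw [edist_comm, edist_eq_enorm_sub]
  obtain heq | hne := eq_or_ne p.1 p.2
  · simp [heq, hm]
  have hpos : 0 < |(p.2 : ℝ) - p.1| :=
    abs_pos.2 (sub_ne_zero.2 fun h => hne (Subtype.ext h.symm))
  have hle : |(p.2 : ℝ) - p.1| ≤ L := hL _ hp.1.1 _ hp.1.2
  rw [← mul_div_assoc, ENNReal.le_div_iff_mul_le
    (Or.inl (ENNReal.ofReal_pos.2 (by positivity)).ne') (Or.inl ENNReal.ofReal_ne_top), mul_comm]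
  gcongr

lemma setLIntegral_edist_rpow_le (hm : 0 < m) (hβ : 0 ≤ β) (f : C(Set.Icc (0 : ℝ) T, V))
    {I : Set (Set.Icc (0 : ℝ) T)} (hI : MeasurableSet I) {L : ℝ}
    (hL : ∀ r ∈ I, ∀ s ∈ I, |(s : ℝ) - r| ≤ L) :
    ∫⁻ p in I ×ˢ I, edist (f p.1) (f p.2) ^ m ∂((timeMeasure T).prod (timeMeasure T)) ≤
      2 * (ENNReal.ofReal (L ^ (1 + β * m)) * seminorm β m f ^ m) := by
  set ν := (timeMeasure T).prod (timeMeasure T)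
  set D : Set (Set.Icc (0 : ℝ) T × Set.Icc (0 : ℝ) T) := I ×ˢ I ∩ {p | p.1 ≤ p.2}
  have hcover : I ×ˢ I ⊆ D ∪ Prod.swap ⁻¹' D := by
    rintro ⟨r, s⟩ ⟨hr, hs⟩
    exact (le_total r s).imp (fun h => ⟨⟨hr, hs⟩, h⟩) fun h => ⟨⟨hs, hr⟩, h⟩
  have hswap : ∫⁻ p in Prod.swap ⁻¹' D, edist (f p.1) (f p.2) ^ m ∂ν =
      ∫⁻ p in D, edist (f p.1) (f p.2) ^ m ∂ν := by
    have hpres : MeasurePreserving Prod.swap ν ν := Measure.measurePreserving_swap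
    rw [← hpres.setLIntegral_comp_preimage_emb MeasurableEquiv.prodComm.measurableEmbedding _ D]
    simp only [Prod.fst_swap, Prod.snd_swap, edist_comm]
  calc ∫⁻ p in I ×ˢ I, edist (f p.1) (f p.2) ^ m ∂ν
      ≤ ∫⁻ p in D ∪ Prod.swap ⁻¹' D, edist (f p.1) (f p.2) ^ m ∂ν := lintegral_mono_set hcover
    _ ≤ 2 * ∫⁻ p in D, edist (f p.1) (f p.2) ^ m ∂ν :=
      (lintegral_union_le _ _ _).trans_eq (by rw [hswap, two_mul])
    _ ≤ 2 * (ENNReal.ofReal (L ^ (1 + β * m)) * seminorm β m f ^ m) := by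
      gcongr
      exact setLIntegral_edist_rpow_inter_simplex_le hm hβ f hI hL

lemma lintegral_edist_cond_prod_cond_le (hm : 1 ≤ m) (hβ : 0 ≤ β) (f : C(Set.Icc (0 : ℝ) T, V))
    {I : Set (Set.Icc (0 : ℝ) T)} (hI : MeasurableSet I) {L : ℝ} (hL0 : 0 < L)
    (hL : ∀ r ∈ I, ∀ s ∈ I, |(s : ℝ) - r| ≤ L) (hμ : timeMeasure T I = ENNReal.ofReal L) :
    ∫⁻ p, edist (f p.1) (f p.2) ∂((timeMeasure T)[|I].prod (timeMeasure T)[|I]) ≤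
      2 * ENNReal.ofReal (L ^ (β - 1 / m)) * seminorm β m f := by
  have hm0 : 0 < m := one_pos.trans_le hm
  have := cond_isProbabilityMeasure (μ := timeMeasure T) (s := I) (by simpa [hμ] using hL0)
  have htwo : (2 : ℝ≥0∞) ^ (1 / m) ≤ 2 :=
    (ENNReal.rpow_le_rpow_of_exponent_le (by norm_num) (by rwa [div_le_one hm0])).trans_eq
      (ENNReal.rpow_one 2)
  have hscale : (ENNReal.ofReal L)⁻¹ * (ENNReal.ofReal L)⁻¹ * ENNReal.ofReal (L ^ (1 + β * m)) =
      ENNReal.ofReal (L ^ (β - 1 / m)) ^ m := by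
    rw [← ENNReal.ofReal_inv_of_pos hL0, ← ENNReal.ofReal_mul (by positivity),
      ← ENNReal.ofReal_mul (by positivity), ENNReal.ofReal_rpow_of_pos (by positivity),
      ← Real.rpow_mul hL0.le, ← Real.rpow_neg_one, ← Real.rpow_add hL0, ← Real.rpow_add hL0]
    congr 2
    field_simp
    ring
  calc ∫⁻ p, edist (f p.1) (f p.2) ∂((timeMeasure T)[|I].prod (timeMeasure T)[|I])
      ≤ (∫⁻ p, edist (f p.1) (f p.2) ^ m ∂((timeMeasure T)[|I].prod (timeMeasure T)[|I])) ^
          (1 / m) :=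
        lintegral_le_rpow_lintegral_rpow _ (Continuous.measurable (by fun_prop)).aemeasurable hm
    _ = ((ENNReal.ofReal L)⁻¹ * (ENNReal.ofReal L)⁻¹ * ∫⁻ p in I ×ˢ I, edist (f p.1) (f p.2) ^ m
          ∂((timeMeasure T).prod (timeMeasure T))) ^ (1 / m) := by
        rw [ProbabilityTheory.cond, Measure.prod_smul_left, Measure.prod_smul_right, smul_smul,
          Measure.prod_restrict, lintegral_smul_measure, hμ, smul_eq_mul]
    _ ≤ ((ENNReal.ofReal L)⁻¹ * (ENNReal.ofReal L)⁻¹ *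
          (2 * (ENNReal.ofReal (L ^ (1 + β * m)) * seminorm β m f ^ m))) ^ (1 / m) := by
        gcongr
        exact setLIntegral_edist_rpow_le hm0 hβ f hI hL
    _ = 2 ^ (1 / m) * ENNReal.ofReal (L ^ (β - 1 / m)) * seminorm β m f := by
        rw [mul_left_comm, ← mul_assoc _ _ (seminorm β m f ^ m), hscale,
          ENNReal.mul_rpow_of_nonneg _ _ (by positivity),
          ENNReal.mul_rpow_of_nonneg _ _ (by positivity), ← ENNReal.rpow_mul, ← ENNReal.rpow_mul,
          mul_one_div_cancel hm0.ne', ENNReal.rpow_one, ENNReal.rpow_one, mul_assoc]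
    _ ≤ 2 * ENNReal.ofReal (L ^ (β - 1 / m)) * seminorm β m f := by gcongr

/-- The image of `[0, T]` under the homothety of centre `t` and ratio `l`. As `l → 0` it shrinks to
`t` and, unlike an interval centred at `t`, it stays in `[0, T]`. -/
def homothetyImage (t : Set.Icc (0 : ℝ) T) (l : ℝ) : Set (Set.Icc (0 : ℝ) T) :=
  Subtype.val ⁻¹' Set.Icc (t - l * t) (t + l * (T - t))

lemma measurableSet_homothetyImage (t : Set.Icc (0 : ℝ) T) (l : ℝ) :
    MeasurableSet (homothetyImage t l) :=
  measurableSet_Icc.preimage measurable_subtype_coe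

lemma homothetyImage_one (t : Set.Icc (0 : ℝ) T) : homothetyImage t 1 = Set.univ := by
  refine Set.eq_univ_of_forall fun s => ?_
  simp [homothetyImage]

lemma homothetyImage_mono (t : Set.Icc (0 : ℝ) T) : Monotone (homothetyImage t) := by
  intro l l' hl
  have := t.2.1
  have := sub_nonneg.2 t.2.2
  exact Set.preimage_mono (Set.Icc_subset_Icc (by gcongr) (by gcongr))

lemma mem_homothetyImage_self (t : Set.Icc (0 : ℝ) T) {l : ℝ} (hl : 0 ≤ l) :
    t ∈ homothetyImage t l :=
  ⟨sub_le_self _ (mul_nonneg hl t.2.1), le_add_of_nonneg_right (mul_nonneg hl (sub_nonneg.2 t.2.2))⟩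

lemma abs_sub_le_of_mem_homothetyImage {t : Set.Icc (0 : ℝ) T} {l : ℝ} {r s : Set.Icc (0 : ℝ) T}
    (hr : r ∈ homothetyImage t l) (hs : s ∈ homothetyImage t l) : |(s : ℝ) - r| ≤ T * l := by
  rw [abs_le]
  exact ⟨by linarith [hr.2, hs.1], by linarith [hr.1, hs.2]⟩

lemma timeMeasure_homothetyImage (t : Set.Icc (0 : ℝ) T) {l : ℝ} (hl : l ≤ 1) :
    timeMeasure T (homothetyImage t l) = ENNReal.ofReal (T * l) := by
  rw [homothetyImage, timeMeasure_preimage_Icc]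
  · congr 1; ring
  · nlinarith [t.2.1]
  · nlinarith [t.2.2]

lemma tendsto_lintegral_edist_homothetyImage (hT : 0 < T) (f : C(Set.Icc (0 : ℝ) T, V))
    (t : Set.Icc (0 : ℝ) T) :
    Filter.Tendsto
      (fun n : ℕ => ∫⁻ s, edist (f t) (f s) ∂(timeMeasure T)[|homothetyImage t ((1 / 2) ^ n)])
      Filter.atTop (nhds 0) := by
  have hprob (n : ℕ) : IsProbabilityMeasure (timeMeasure T)[|homothetyImage t ((1 / 2) ^ n)] := by
    refine cond_isProbabilityMeasure ?_
    rw [timeMeasure_homothetyImage t (pow_le_one₀ (by norm_num) (by norm_num))]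
    exact (ENNReal.ofReal_pos.2 (by positivity)).ne'
  refine tendsto_lintegral_edist_of_ae_mem (fun U hU => ?_) f.continuous.continuousAt
  obtain ⟨δ, hδ, hball⟩ := Metric.mem_nhds_iff.1 hU
  have hlength : Filter.Tendsto (fun n : ℕ => T * (1 / 2 : ℝ) ^ n) Filter.atTop (nhds 0) := by
    simpa using (tendsto_pow_atTop_nhds_zero_of_lt_one (r := (1 / 2 : ℝ)) (by norm_num)
      (by norm_num)).const_mul T
  filter_upwards [hlength.eventually_lt_const hδ] with n hn
  filter_upwards [ae_cond_mem (measurableSet_homothetyImage t _)] with s hs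
  have hself := mem_homothetyImage_self t (l := (1 / 2) ^ n) (by positivity)
  exact hball ((abs_sub_le_of_mem_homothetyImage hself hs).trans_lt hn)

lemma lintegral_edist_cond_univ_le (hT : 0 < T) (hm : 1 ≤ m) (hβ : 0 ≤ β)
    (f : C(Set.Icc (0 : ℝ) T, V)) (t : Set.Icc (0 : ℝ) T) :
    ∫⁻ s, edist (f t) (f s) ∂(timeMeasure T)[|Set.univ] ≤
      (∑' n : ℕ, 4 * ENNReal.ofReal ((T * (1 / 2) ^ n) ^ (β - 1 / m))) * seminorm β m f := by
  suffices hstep : ∀ n : ℕ,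
      ∫⁻ s, edist (f t) (f s) ∂(timeMeasure T)[|homothetyImage t ((1 / 2) ^ n)] ≤
        ∫⁻ s, edist (f t) (f s) ∂(timeMeasure T)[|homothetyImage t ((1 / 2) ^ (n + 1))] +
          4 * ENNReal.ofReal ((T * (1 / 2) ^ n) ^ (β - 1 / m)) * seminorm β m f by
    simpa only [pow_zero, homothetyImage_one, ENNReal.tsum_mul_right] using
      le_tsum_of_le_add_of_tendsto_zero hstep (tendsto_lintegral_edist_homothetyImage hT f t)
  intro n
  have hpow : (1 / 2 : ℝ) ^ (n + 1) ≤ (1 / 2) ^ n :=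
    pow_le_pow_of_le_one (by norm_num) (by norm_num) n.le_succ
  have hle : (1 / 2 : ℝ) ^ n ≤ 1 := pow_le_one₀ (by norm_num) (by norm_num)
  have hpos : 0 < T * (1 / 2 : ℝ) ^ n := by positivity
  have hI := timeMeasure_homothetyImage t hle
  have hhalf : timeMeasure T (homothetyImage t ((1 / 2) ^ n)) ≤
      2 * timeMeasure T (homothetyImage t ((1 / 2) ^ (n + 1))) := by
    rw [hI, timeMeasure_homothetyImage t (hpow.trans hle), ← ENNReal.ofReal_ofNat,
      ← ENNReal.ofReal_mul (by norm_num)]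
    exact ENNReal.ofReal_le_ofReal (by rw [pow_succ]; linarith)
  have hosc := lintegral_edist_cond_prod_cond_le hm hβ f (measurableSet_homothetyImage t _) hpos
    (fun _ hr _ hs => abs_sub_le_of_mem_homothetyImage hr hs) hI
  refine (lintegral_edist_cond_le (timeMeasure T) (homothetyImage_mono t hpow)
    (by rw [hI]; simpa using hpos) hhalf f.continuous.stronglyMeasurable (f t)).trans ?_
  grw [hosc]
  exact le_of_eq (by ring)

lemma tsum_ofReal_mul_half_pow_rpow_ne_top (hT : 0 ≤ T) {γ : ℝ} (hγ : 0 < γ) :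
    ∑' n : ℕ, ENNReal.ofReal ((T * (1 / 2) ^ n) ^ γ) ≠ ∞ := by
  refine Summable.tsum_ofReal_ne_top (Summable.congr ((summable_geometric_of_lt_one
    (r := (1 / 2) ^ γ) (by positivity) (Real.rpow_lt_one (by norm_num) (by norm_num) hγ)).mul_left
      (T ^ γ)) fun n => ?_)
  rw [Real.mul_rpow hT (by positivity), Real.rpow_pow_comm (by norm_num)]

lemma exists_edist_le_mul_seminorm (hT : 0 < T) (hm : 1 ≤ m) (hβ : 1 / m < β) :
    ∃ C : ℝ≥0∞, C ≠ ∞ ∧ ∀ (f : C(Set.Icc (0 : ℝ) T, V)) (s t : Set.Icc (0 : ℝ) T),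
      edist (f s) (f t) ≤ C * seminorm β m f := by
  have hβ0 : 0 ≤ β := le_trans (by positivity) hβ.le
  set K := ∑' n : ℕ, 4 * ENNReal.ofReal ((T * (1 / 2) ^ n) ^ (β - 1 / m)) with hKdef
  have hK : K ≠ ∞ := by
    rw [hKdef, ENNReal.tsum_mul_left]
    exact ENNReal.mul_ne_top (by simp)
      (tsum_ofReal_mul_half_pow_rpow_ne_top hT.le (sub_pos.2 hβ))
  refine ⟨2 * K, ENNReal.mul_ne_top (by simp) hK, fun f s t => ?_⟩
  set P := (timeMeasure T)[|Set.univ]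
  have : IsProbabilityMeasure P := by
    refine cond_isProbabilityMeasure ?_
    rw [← homothetyImage_one s, timeMeasure_homothetyImage s le_rfl]
    simpa using hT
  calc edist (f s) (f t) = ∫⁻ _, edist (f s) (f t) ∂P := by simp
    _ ≤ ∫⁻ r, edist (f s) (f r) + edist (f t) (f r) ∂P := by
      gcongr
      exact edist_triangle_right _ _ _
    _ = ∫⁻ r, edist (f s) (f r) ∂P + ∫⁻ r, edist (f t) (f r) ∂P :=
      lintegral_add_left (Continuous.measurable (by fun_prop)) _
    _ ≤ K * seminorm β m f + K * seminorm β m f :=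
      add_le_add (lintegral_edist_cond_univ_le hT hm hβ0 f s)
        (lintegral_edist_cond_univ_le hT hm hβ0 f t)
    _ = 2 * K * seminorm β m f := by ring

end Embedding

section Evaluation

variable {T β m : ℝ} [hm : Fact (1 ≤ m)] [hT : Fact (0 < T)]
  {V : Type*} [NormedAddCommGroup V] [NormedSpace ℝ V]

lemma exists_norm_apply_le (hβ : 1 / m < β) :
    ∃ C : ℝ, ∀ (f : BesovPath T β m V) (t : Set.Icc (0 : ℝ) T), ‖f t‖ ≤ C * ‖f‖ := by
  obtain ⟨C, hC, hosc⟩ := exists_edist_le_mul_seminorm (V := V) hT.out hm.out hβ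
  refine ⟨1 + C.toReal, fun f t => ?_⟩
  have hdist : ‖f t - f (start T)‖ ≤ C.toReal * (seminorm β m f.toContinuousMap).toReal := by
    rw [← ENNReal.toReal_mul, ← toReal_enorm, ← edist_eq_enorm_sub]
    exact ENNReal.toReal_mono (ENNReal.mul_ne_top hC (ne_of_lt f.2)) (hosc _ _ _)
  calc ‖f t‖ ≤ ‖f (start T)‖ + C.toReal * (seminorm β m f.toContinuousMap).toReal :=
        (norm_le_norm_add_norm_sub' _ _).trans (by gcongr)
    _ ≤ ‖f‖ + C.toReal * ‖f‖ := by
        rw [norm_def]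
        gcongr <;> simp
    _ = (1 + C.toReal) * ‖f‖ := by ring

/-- Evaluation at `t` as a continuous linear map. Its continuity is the Besov embedding into
continuous functions, which is where `1 / m < β` enters. -/
def evalCLM (hβ : 1 / m < β) (t : Set.Icc (0 : ℝ) T) : BesovPath T β m V →L[ℝ] V :=
  LinearMap.mkContinuousOfExistsBound
    { toFun := fun f => f t
      map_add' := fun _ _ => rfl
      map_smul' := fun _ _ => rfl }
    ((exists_norm_apply_le hβ).imp fun _ h f => h f t)

end Evaluation

end BesovPath

section Fourier

lemma norm_fourier_apply {T : ℝ} (n : ℤ) (z : AddCircle T) : ‖fourier n z‖ = 1 :=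
  Circle.norm_coe _

lemma fourierCoeff_tsum_mul_fourier {T : ℝ} [Fact (0 < T)] {c : ℤ → ℂ}
    (hc : Summable fun n => ‖c n‖) (n : ℤ) :
    fourierCoeff (fun z : AddCircle T => ∑' k, c k * fourier k z) n = c n := by
  have hint (k : ℤ) : Integrable (fun z : AddCircle T => fourier (-n) z * (c k * fourier k z))
      AddCircle.haarAddCircle :=
    Continuous.integrable_of_hasCompactSupport (by fun_prop) (HasCompactSupport.of_compactSpace _)
  have hnorm (k : ℤ) : ∫ z : AddCircle T, ‖fourier (-n) z * (c k * fourier k z)‖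
      ∂AddCircle.haarAddCircle = ‖c k‖ := by
    simp only [norm_mul, norm_fourier_apply, one_mul, mul_one, integral_const, probReal_univ,
      one_smul]
  have hcoeff (k : ℤ) : ∫ z : AddCircle T, fourier (-n) z * (c k * fourier k z)
      ∂AddCircle.haarAddCircle = if k = n then c n else 0 := by
    calc ∫ z : AddCircle T, fourier (-n) z * (c k * fourier k z) ∂AddCircle.haarAddCircle
        = c k * fourierCoeff (fourier k : AddCircle T → ℂ) n := by
          rw [fourierCoeff, ← integral_const_mul]
          simp only [smul_eq_mul, mul_left_comm]
      _ = if k = n then c n else 0 := by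
          rw [fourierCoeff_fourier]
          split_ifs with hk
          · rw [hk, Pi.single_eq_same, mul_one]
          · rw [Pi.single_eq_of_ne' hk, mul_zero]
  have hsum := hasSum_integral_of_summable_integral_norm hint (by simpa only [hnorm] using hc)
  simp only [hcoeff, tsum_mul_left] at hsum
  exact (hasSum_ite_eq n (c n)).unique hsum |>.symm

lemma tsum_enorm_sq_fourierCoeffOn {a b : ℝ} (hab : a < b) {f : ℝ → ℂ}
    (hf : MemLp f 2 (volume.restrict (Set.Ioc a b))) :
    ∑' n, ‖fourierCoeffOn hab f n‖ₑ ^ 2 =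
      ENNReal.ofReal (b - a)⁻¹ * ∫⁻ z in Set.Ioc a b, ‖f z‖ₑ ^ 2 := by
  have hsq (z : ℂ) : ‖z‖ₑ ^ 2 = ENNReal.ofReal (‖z‖ ^ 2) := by
    rw [ENNReal.ofReal_pow (norm_nonneg _), ofReal_norm]
  have hparseval := hasSum_sq_fourierCoeffOn hab hf
  simp only [hsq]
  rw [← ENNReal.ofReal_tsum_of_nonneg (fun _ => by positivity) hparseval.summable,
    hparseval.tsum_eq, smul_eq_mul, ENNReal.ofReal_mul (inv_nonneg.2 (sub_nonneg.2 hab.le)),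
    intervalIntegral.integral_of_le hab.le,
    ofReal_integral_eq_lintegral_ofReal (hf.integrable_norm_pow two_ne_zero)
      (Filter.Eventually.of_forall fun _ => by positivity)]

lemma fourierCoeffOn_zero_one (f : ℝ → ℂ) (n : ℤ) :
    fourierCoeffOn zero_lt_one f n =
      ∫ z in (0 : ℝ)..1, fourier (-n) (z : UnitAddCircle) * f z := by
  rw [fourierCoeffOn_eq_integral]
  simp only [sub_zero, div_one, one_smul, smul_eq_mul, fourier_coe_apply]

lemma lintegral_enorm_sq_tsum_mul_fourier {c : ℤ → ℂ} (hc : Summable fun n => ‖c n‖) :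
    ∫⁻ z in Set.Icc (0 : ℝ) 1, ‖∑' n, c n * fourier n (z : UnitAddCircle)‖ₑ ^ 2 =
      ∑' n, ‖c n‖ₑ ^ 2 := by
  have hcont : Continuous fun z : ℝ => ∑' n, c n * fourier n (z : UnitAddCircle) :=
    continuous_tsum (fun n => continuous_const.mul
      ((fourier n).continuous.comp (AddCircle.continuous_mk' 1))) hc
      fun n z => by rw [norm_mul, norm_fourier_apply, mul_one]
  have hmem : MemLp (fun z : ℝ => ∑' n, c n * fourier n (z : UnitAddCircle)) 2
      (volume.restrict (Set.Ioc (0 : ℝ) 1)) := by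
    refine MemLp.of_bound (C := ∑' n, ‖c n‖) hcont.aestronglyMeasurable
      (Filter.Eventually.of_forall fun z => ?_)
    refine tsum_of_norm_bounded hc.hasSum fun n => ?_
    rw [norm_mul, norm_fourier_apply, mul_one]
  have hcoeff (n : ℤ) : fourierCoeffOn zero_lt_one
      (fun z : ℝ => ∑' k, c k * fourier k (z : UnitAddCircle)) n = c n := by
    rw [← fourierCoeff_tsum_mul_fourier (T := 1) hc n, fourierCoeffOn_zero_one,
      fourierCoeff_eq_intervalIntegral _ n 0]
    simp only [zero_add, div_one, one_smul, smul_eq_mul]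
  have hparseval := tsum_enorm_sq_fourierCoeffOn zero_lt_one hmem
  simp only [hcoeff, sub_zero, inv_one, ENNReal.ofReal_one, one_mul] at hparseval
  rw [hparseval]
  exact setLIntegral_congr Ioc_ae_eq_Icc.symm

end Fourier

section HeatKernel

/-- The `n`-th Fourier multiplier of the heat semigroup of the circle `ℝ/ℤ` at time `τ`. -/
def heatMultiplier (τ : ℝ) (n : ℤ) : ℝ := Real.exp (-(4 * Real.pi ^ 2 * n ^ 2) * τ)

lemma heatMultiplier_pos (τ : ℝ) (n : ℤ) : 0 < heatMultiplier τ n := Real.exp_pos _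

lemma heatMultiplier_neg (τ : ℝ) (n : ℤ) : heatMultiplier τ (-n) = heatMultiplier τ n := by
  simp [heatMultiplier]

lemma continuous_heatMultiplier (n : ℤ) : Continuous fun τ => heatMultiplier τ n := by
  unfold heatMultiplier
  fun_prop

lemma summable_heatMultiplier {τ : ℝ} (hτ : 0 < τ) : Summable (heatMultiplier τ) := by
  refine (summable_pow_mul_jacobiTheta₂_term_bound 0 (T := 4 * Real.pi * τ)
    (by positivity) 0).congr fun n => ?_
  rw [pow_zero, one_mul, heatMultiplier]
  congr 1
  ring

lemma ofReal_periodicHeatKernel (τ x : ℝ) :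
    (periodicHeatKernel τ x : ℂ) = 1 / (√(4 * Real.pi * τ) : ℂ) * ∑' n : ℤ,
      Complex.exp (-Real.pi / (4 * Real.pi * τ : ℝ) * (n + Complex.I * (-Complex.I * x)) ^ 2) := by
  rw [periodicHeatKernel, ← tsum_mul_left, Complex.ofReal_tsum]
  refine tsum_congr fun n => ?_
  have hI : (n + Complex.I * (-Complex.I * x) : ℂ) = x + n := by
    linear_combination (-(x : ℂ)) * Complex.I_sq
  have hpi : (Real.pi : ℂ) ≠ 0 := by exact_mod_cast Real.pi_ne_zero
  rw [heatKernel, hI]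
  push_cast
  congr 2
  obtain rfl | hτ := eq_or_ne τ 0
  · simp
  · have hτ' : (τ : ℂ) ≠ 0 := by exact_mod_cast hτ
    field_simp

lemma hasSum_periodicHeatKernel {τ : ℝ} (hτ : 0 < τ) (x : ℝ) :
    HasSum (fun n : ℤ => (heatMultiplier τ n : ℂ) * fourier n (x : UnitAddCircle))
      (periodicHeatKernel τ x : ℂ) := by
  have hsummable : Summable fun n : ℤ =>
      (heatMultiplier τ n : ℂ) * fourier n (x : UnitAddCircle) := by
    refine Summable.of_norm_bounded (summable_heatMultiplier hτ) fun n => ?_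
    rw [norm_mul, norm_fourier_apply, mul_one, Complex.norm_real,
      Real.norm_of_nonneg (heatMultiplier_pos τ n).le]
  have hpoisson := Complex.tsum_exp_neg_quadratic (a := (4 * Real.pi * τ : ℝ))
    (by rw [Complex.ofReal_re]; positivity) (-Complex.I * x)
  have hroot : ((4 * Real.pi * τ : ℝ) : ℂ) ^ (1 / 2 : ℂ) = (√(4 * Real.pi * τ) : ℝ) := by
    rw [Real.sqrt_eq_rpow, Complex.ofReal_cpow (by positivity)]
    simp
  suffices hsum : (periodicHeatKernel τ x : ℂ) =
      ∑' n : ℤ, (heatMultiplier τ n : ℂ) * fourier n (x : UnitAddCircle) by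
    rw [hsum]
    exact hsummable.hasSum
  rw [ofReal_periodicHeatKernel, ← hroot, ← hpoisson]
  -- Both frequencies occur in the series, so the sign of `x` in Poisson's formula is immaterial.
  refine ((Equiv.neg ℤ).tsum_eq _).symm.trans (tsum_congr fun n => ?_)
  rw [fourier_coe_apply, heatMultiplier, Complex.ofReal_exp, ← Complex.exp_add]
  congr 1
  simp only [Equiv.neg_apply]
  push_cast
  ring

lemma measurable_duhamelKernel (t x : ℝ) : Measurable (duhamelKernel t x) := by
  have hheat : Measurable fun p : ℝ × ℝ => heatKernel p.1 p.2 := by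
    unfold heatKernel
    fun_prop
  have hperiodic : Measurable fun p : ℝ × ℝ => periodicHeatKernel p.1 p.2 := by
    unfold periodicHeatKernel
    exact Measurable.tsum fun n =>
      hheat.comp (by fun_prop : Measurable fun p : ℝ × ℝ => (p.1, p.2 + n))
  unfold duhamelKernel
  refine Measurable.ite (measurableSet_lt measurable_fst measurable_const) ?_ measurable_const
  exact hperiodic.comp (by fun_prop : Measurable fun p : ℝ × ℝ => (t - p.1, x - p.2))

end HeatKernel

section Variance

/-- The `n`-th Fourier coefficient `∑ₓ aₓ e^{-2πinx}` of the discrete measure `∑ₓ aₓ δₓ`. -/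
def fourierWeight (n : ℤ) : (Set.Icc (0 : ℝ) 1 →₀ ℝ) →ₗ[ℝ] ℂ :=
  Finsupp.linearCombination ℝ fun x => fourier (-n) ((x : ℝ) : UnitAddCircle)

/-- The combination `∑ₓ aₓ K_{t,x}` of Duhamel kernels, i.e. the integrand of `∑ₓ aₓ ψ(t, x)`. -/
def duhamelCombination (t : ℝ) : (Set.Icc (0 : ℝ) 1 →₀ ℝ) →ₗ[ℝ] (ℝ × ℝ → ℝ) :=
  Finsupp.linearCombination ℝ fun x => duhamelKernel t x

/-- The variance at time `t` of the `n`-th Fourier mode of the stochastic heat equation. -/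
def modeVariance (t : ℝ) (n : ℤ) : ℝ≥0∞ :=
  ∫⁻ s in Set.Ico 0 t, ENNReal.ofReal (heatMultiplier (t - s) n ^ 2)

lemma norm_fourierWeight_le (n : ℤ) (a : Set.Icc (0 : ℝ) 1 →₀ ℝ) :
    ‖fourierWeight n a‖ ≤ a.sum fun _ r => |r| := by
  rw [fourierWeight, Finsupp.linearCombination_apply, Finsupp.sum]
  refine (norm_sum_le _ _).trans (Finset.sum_le_sum fun x _ => ?_)
  rw [norm_smul, norm_fourier_apply, mul_one, Real.norm_eq_abs]

lemma measurable_duhamelCombination (t : ℝ) (a : Set.Icc (0 : ℝ) 1 →₀ ℝ) :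
    Measurable (duhamelCombination t a) := by
  induction a using Finsupp.induction_linear with
  | zero =>
    rw [map_zero]
    exact measurable_zero
  | add a b ha hb =>
    rw [map_add]
    exact ha.add hb
  | single x r =>
    rw [duhamelCombination, Finsupp.linearCombination_single]
    exact (measurable_duhamelKernel t x).const_smul r

lemma duhamelCombination_eq_zero {t s : ℝ} (hts : t ≤ s) (a : Set.Icc (0 : ℝ) 1 →₀ ℝ) (z : ℝ) :
    duhamelCombination t a (s, z) = 0 := by
  rw [duhamelCombination, Finsupp.linearCombination_apply, Finsupp.sum, Finset.sum_apply]
  exact Finset.sum_eq_zero fun x _ => by simp [duhamelKernel, hts.not_gt]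

lemma hasSum_duhamelCombination {t s : ℝ} (hst : s < t) (a : Set.Icc (0 : ℝ) 1 →₀ ℝ) (z : ℝ) :
    HasSum (fun n : ℤ => heatMultiplier (t - s) n * fourierWeight n a *
      fourier n (z : UnitAddCircle)) (duhamelCombination t a (s, z) : ℂ) := by
  induction a using Finsupp.induction_linear with
  | zero => simp
  | add a b ha hb =>
    simp only [map_add, Pi.add_apply, Complex.ofReal_add, mul_add, add_mul]
    exact ha.add hb
  | single x r =>
    have hkernel := (Equiv.neg ℤ).hasSum_iff.2 (hasSum_periodicHeatKernel (sub_pos.2 hst) (x - z))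
    convert! hkernel.mul_left (r : ℂ) using 1
    · ext n
      simp only [fourierWeight, Finsupp.linearCombination_single, Complex.real_smul,
        Function.comp_apply, Equiv.neg_apply, heatMultiplier_neg, fourier_coe_apply]
      rw [mul_assoc, mul_assoc, ← Complex.exp_add, mul_left_comm]
      congr 3
      push_cast
      ring
    · simp [duhamelCombination, duhamelKernel, hst]

lemma lintegral_enorm_sq_duhamelCombination_slice {t s : ℝ} (hst : s < t)
    (a : Set.Icc (0 : ℝ) 1 →₀ ℝ) :
    ∫⁻ z in Set.Icc (0 : ℝ) 1, ‖duhamelCombination t a (s, z)‖ₑ ^ 2 =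
      ∑' n : ℤ, ENNReal.ofReal (heatMultiplier (t - s) n ^ 2) * ‖fourierWeight n a‖ₑ ^ 2 := by
  have hsummable : Summable fun n : ℤ => ‖(heatMultiplier (t - s) n * fourierWeight n a : ℂ)‖ := by
    refine Summable.of_nonneg_of_le (fun _ => norm_nonneg _) (fun n => ?_)
      ((summable_heatMultiplier (sub_pos.2 hst)).mul_right (a.sum fun _ r => |r|))
    rw [norm_mul, Complex.norm_real, Real.norm_of_nonneg (heatMultiplier_pos _ _).le]
    exact mul_le_mul_of_nonneg_left (norm_fourierWeight_le n a) (heatMultiplier_pos _ _).le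
  have hreal (r : ℝ) : ‖(r : ℂ)‖ₑ = ‖r‖ₑ := by
    rw [← ofReal_norm, Complex.norm_real, ofReal_norm]
  have hparseval := lintegral_enorm_sq_tsum_mul_fourier hsummable
  simp only [(hasSum_duhamelCombination hst a _).tsum_eq, hreal] at hparseval
  rw [hparseval]
  refine tsum_congr fun n => ?_
  rw [enorm_mul, hreal, mul_pow, ENNReal.ofReal_pow (heatMultiplier_pos _ _).le,
    Real.enorm_of_nonneg (heatMultiplier_pos _ _).le]

theorem lintegral_enorm_sq_duhamelCombination {T : ℝ} (t : Set.Icc (0 : ℝ) T)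
    (a : Set.Icc (0 : ℝ) 1 →₀ ℝ) :
    ∫⁻ p, ‖duhamelCombination t a p‖ₑ ^ 2 ∂spaceTimeMeasure T =
      ∑' n : ℤ, modeVariance t n * ‖fourierWeight n a‖ₑ ^ 2 := by
  have hmeas (n : ℤ) : Measurable fun s : ℝ => ENNReal.ofReal (heatMultiplier (t - s) n ^ 2) :=
    ((((continuous_heatMultiplier n).comp (continuous_const.sub continuous_id)).pow 2).measurable
      ).ennreal_ofReal
  have hslice (s : ℝ) : ∫⁻ z in Set.Icc (0 : ℝ) 1, ‖duhamelCombination t a (s, z)‖ₑ ^ 2 =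
      (Set.Iio (t : ℝ)).indicator (fun s => ∑' n : ℤ,
        ENNReal.ofReal (heatMultiplier (t - s) n ^ 2) * ‖fourierWeight n a‖ₑ ^ 2) s := by
    by_cases hs : s < t
    · rw [Set.indicator_of_mem (Set.mem_Iio.2 hs), lintegral_enorm_sq_duhamelCombination_slice hs]
    · rw [Set.indicator_of_notMem (Set.notMem_Iio.2 (not_lt.1 hs))]
      simp [duhamelCombination_eq_zero (not_lt.1 hs)]
  have htime : Set.Iio (t : ℝ) ∩ Set.Icc 0 T = Set.Ico 0 (t : ℝ) := by
    ext s
    exact ⟨fun hs => ⟨hs.2.1, hs.1⟩, fun hs => ⟨hs.2, hs.1, hs.2.le.trans t.2.2⟩⟩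
  rw [spaceTimeMeasure,
    lintegral_prod _ ((measurable_duhamelCombination t a).enorm.pow_const 2).aemeasurable]
  simp only [hslice]
  rw [lintegral_indicator measurableSet_Iio, Measure.restrict_restrict measurableSet_Iio, htime,
    lintegral_tsum fun n => ((hmeas n).mul_const _).aemeasurable]
  exact tsum_congr fun n => lintegral_mul_const _ (hmeas n)

lemma modeVariance_zero (t : ℝ) : modeVariance t 0 = ENNReal.ofReal t := by
  simp [modeVariance, heatMultiplier]

lemma modeVariance_le {t : ℝ} (ht : 0 ≤ t) {n : ℤ} (hn : n ≠ 0) :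
    modeVariance t n ≤ ENNReal.ofReal (1 / (8 * Real.pi ^ 2 * n ^ 2)) := by
  have : (n : ℝ) ≠ 0 := by exact_mod_cast hn
  set c : ℝ := 8 * Real.pi ^ 2 * n ^ 2
  have hc : 0 < c := by positivity
  have hsq (s : ℝ) : heatMultiplier (t - s) n ^ 2 = Real.exp (-c * (t - s)) := by
    rw [heatMultiplier, ← Real.exp_nat_mul]
    congr 1
    push_cast
    ring
  have hcont : Continuous fun s => Real.exp (-c * (t - s)) := by fun_prop
  have hderiv (s : ℝ) :
      HasDerivAt (fun s => Real.exp (-c * (t - s)) / c) (Real.exp (-c * (t - s))) s := by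
    have hlin : HasDerivAt (fun s => -c * (t - s)) c s := by
      simpa using ((hasDerivAt_id s).const_sub t).const_mul (-c)
    convert! hlin.exp.div_const c using 1
    field_simp
  simp only [modeVariance, hsq]
  rw [← ofReal_integral_eq_lintegral_ofReal
      (hcont.integrableOn_Icc.mono_set Set.Ico_subset_Icc_self)
      (Filter.Eventually.of_forall fun _ => (Real.exp_pos _).le),
    integral_Ico_eq_integral_Ioc, ← intervalIntegral.integral_of_le ht,
    intervalIntegral.integral_eq_sub_of_hasDerivAt (fun s _ => hderiv s)
      (hcont.intervalIntegrable _ _), sub_self, mul_zero, Real.exp_zero]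
  exact ENNReal.ofReal_le_ofReal (sub_le_self _ (by positivity))

lemma hasSum_one_div_eight_pi_sq_mul_int_sq :
    HasSum (fun n : ℤ => 1 / (8 * Real.pi ^ 2 * (n : ℝ) ^ 2)) (1 / 24) := by
  have hzeta : HasSum (fun n : ℕ => 1 / (8 * Real.pi ^ 2 * (n : ℝ) ^ 2)) (1 / 48) := by
    convert! hasSum_zeta_two.mul_left (1 / (8 * Real.pi ^ 2)) using 1
    · ext n
      rw [div_mul_div_comm, one_mul]
    · field_simp
      norm_num
  convert! hzeta.of_nat_of_neg (f := fun n : ℤ => 1 / (8 * Real.pi ^ 2 * (n : ℝ) ^ 2))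
    (by simpa using hzeta) using 1
  norm_num

lemma tsum_modeVariance_le {t : ℝ} (ht : 0 ≤ t) :
    ∑' n, modeVariance t n ≤ ENNReal.ofReal (t + 1 / 24) := by
  have hbasel := hasSum_one_div_eight_pi_sq_mul_int_sq
  calc ∑' n, modeVariance t n
      ≤ ∑' n : ℤ, ((if n = 0 then ENNReal.ofReal t else 0) +
          ENNReal.ofReal (1 / (8 * Real.pi ^ 2 * (n : ℝ) ^ 2))) := by
        refine ENNReal.tsum_le_tsum fun n => ?_
        split_ifs with hn
        · simp [hn, modeVariance_zero]
        · simpa using modeVariance_le ht hn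
    _ = ENNReal.ofReal (t + 1 / 24) := by
        rw [ENNReal.tsum_add, tsum_ite_eq,
          ← ENNReal.ofReal_tsum_of_nonneg (fun n => by positivity) hbasel.summable,
          hbasel.tsum_eq, ENNReal.ofReal_add ht (by norm_num)]

lemma modeVariance_mul_enorm_sq_le {t : ℝ} (ht : 0 ≤ t) (n : ℤ) :
    modeVariance t n * ‖-2 * Real.pi * Complex.I * n‖ₑ ^ 2 ≤ ENNReal.ofReal (1 / 2) := by
  obtain rfl | hn := eq_or_ne n 0
  · simp
  have hn' : (n : ℝ) ≠ 0 := by exact_mod_cast hn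
  have hnorm : ‖-2 * Real.pi * Complex.I * n‖ₑ ^ 2 = ENNReal.ofReal (4 * Real.pi ^ 2 * n ^ 2) := by
    rw [← ofReal_norm, ← ENNReal.ofReal_pow (norm_nonneg _)]
    simp only [norm_neg, norm_mul, Complex.norm_I, Complex.norm_real, Complex.norm_intCast,
      Complex.norm_ofNat, mul_one, mul_pow, Real.norm_eq_abs, sq_abs]
    norm_num
  calc modeVariance t n * ‖-2 * Real.pi * Complex.I * n‖ₑ ^ 2
      ≤ ENNReal.ofReal (1 / (8 * Real.pi ^ 2 * n ^ 2)) *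
          ENNReal.ofReal (4 * Real.pi ^ 2 * n ^ 2) := by
        rw [hnorm]
        gcongr
        exact modeVariance_le ht hn
    _ = ENNReal.ofReal (1 / 2) := by
        rw [← ENNReal.ofReal_mul (by positivity)]
        congr 1
        field_simp
        norm_num

lemma lintegral_enorm_sq_duhamelCombination_single_le {T : ℝ} (t : Set.Icc (0 : ℝ) T)
    (x : Set.Icc (0 : ℝ) 1) (r : ℝ) :
    ∫⁻ p, ‖duhamelCombination t (Finsupp.single x r) p‖ₑ ^ 2 ∂spaceTimeMeasure T ≤
      ENNReal.ofReal (r ^ 2 * (T + 1 / 24)) := by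
  have hweight (n : ℤ) : ‖fourierWeight n (Finsupp.single x r)‖ₑ ^ 2 = ENNReal.ofReal (r ^ 2) := by
    rw [fourierWeight, Finsupp.linearCombination_single, ← ofReal_norm,
      ← ENNReal.ofReal_pow (norm_nonneg _), norm_smul, norm_fourier_apply, mul_one,
      Real.norm_eq_abs, sq_abs]
  rw [lintegral_enorm_sq_duhamelCombination, mul_comm (r ^ 2),
    ENNReal.ofReal_mul' (sq_nonneg r)]
  simp only [hweight]
  rw [ENNReal.tsum_mul_right]
  gcongr
  refine (tsum_modeVariance_le t.2.1).trans (ENNReal.ofReal_le_ofReal ?_)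
  gcongr
  exact t.2.2

end Variance

section StepFunction

/-- The step function with value `b j` on `(u j, u (j + 1)]` for `j < N`. -/
def stepFunction (u : ℕ → Set.Icc (0 : ℝ) 1) (b : ℕ → ℝ) (N : ℕ) (z : ℝ) : ℂ :=
  ∑ j ∈ Finset.range N, (Set.Ioc (u j : ℝ) (u (j + 1))).indicator (fun _ => (b j : ℂ)) z

/-- The signed measure `δ_y - δ_x`, whose pairing with a path is its increment from `x` to `y`. -/
def incrementWeight (x y : Set.Icc (0 : ℝ) 1) : Set.Icc (0 : ℝ) 1 →₀ ℝ :=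
  Finsupp.single y 1 - Finsupp.single x 1

@[simp]
lemma linearCombination_incrementWeight {M : Type*} [AddCommGroup M] [Module ℝ M]
    (g : Set.Icc (0 : ℝ) 1 → M) (x y : Set.Icc (0 : ℝ) 1) :
    Finsupp.linearCombination ℝ g (incrementWeight x y) = g y - g x := by
  simp [incrementWeight]

lemma memLp_stepFunction {μ : Measure ℝ} [IsFiniteMeasure μ] (p : ℝ≥0∞)
    (u : ℕ → Set.Icc (0 : ℝ) 1) (b : ℕ → ℝ) (N : ℕ) : MemLp (stepFunction u b N) p μ :=
  memLp_finsetSum _ fun j _ => (memLp_const (b j : ℂ)).indicator measurableSet_Ioc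

lemma enorm_stepFunction_sq {u : ℕ → Set.Icc (0 : ℝ) 1} (hu : Monotone u) (b : ℕ → ℝ) (N : ℕ)
    (z : ℝ) : ‖stepFunction u b N z‖ₑ ^ 2 = ∑ j ∈ Finset.range N,
      (Set.Ioc (u j : ℝ) (u (j + 1))).indicator (fun _ => ENNReal.ofReal (b j ^ 2)) z := by
  have hdisj {i j : ℕ} (hij : i ≠ j) (hi : z ∈ Set.Ioc (u i : ℝ) (u (i + 1))) :
      z ∉ Set.Ioc (u j : ℝ) (u (j + 1)) :=
    Set.disjoint_left.1 (Monotone.pairwise_disjoint_on_Ioc_succ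
      (f := fun j => (u j : ℝ)) (fun i j h => hu h) hij) hi
  by_cases hz : ∃ j ∈ Finset.range N, z ∈ Set.Ioc (u j : ℝ) (u (j + 1))
  · obtain ⟨j, hj, hzj⟩ := hz
    rw [stepFunction,
      Finset.sum_eq_single_of_mem j hj fun k _ hk => Set.indicator_of_notMem (hdisj hk.symm hzj) _,
      Finset.sum_eq_single_of_mem j hj fun k _ hk => Set.indicator_of_notMem (hdisj hk.symm hzj) _,
      Set.indicator_of_mem hzj, Set.indicator_of_mem hzj, ← ofReal_norm,
      ← ENNReal.ofReal_pow (norm_nonneg _), Complex.norm_real, Real.norm_eq_abs, sq_abs]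
  · push Not at hz
    rw [stepFunction, Finset.sum_eq_zero fun j hj => Set.indicator_of_notMem (hz j hj) _,
      Finset.sum_eq_zero fun j hj => Set.indicator_of_notMem (hz j hj) _]
    simp

lemma lintegral_enorm_sq_stepFunction {u : ℕ → Set.Icc (0 : ℝ) 1} (hu : Monotone u) (b : ℕ → ℝ)
    (N : ℕ) : ∫⁻ z in Set.Ioc (0 : ℝ) 1, ‖stepFunction u b N z‖ₑ ^ 2 =
      ENNReal.ofReal (∑ j ∈ Finset.range N, b j ^ 2 * ((u (j + 1) : ℝ) - u j)) := by
  simp only [enorm_stepFunction_sq hu]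
  rw [lintegral_finsetSum _ fun j _ => measurable_const.indicator measurableSet_Ioc,
    ENNReal.ofReal_sum_of_nonneg fun j _ =>
      mul_nonneg (sq_nonneg _) (sub_nonneg.2 (hu j.le_succ))]
  refine Finset.sum_congr rfl fun j _ => ?_
  rw [lintegral_indicator measurableSet_Ioc, Measure.restrict_restrict measurableSet_Ioc,
    Set.inter_eq_left.2 (Set.Ioc_subset_Ioc (u j).2.1 (u (j + 1)).2.2), setLIntegral_const,
    Real.volume_Ioc, ENNReal.ofReal_mul (sq_nonneg _)]

lemma fourierCoeffOn_indicator_Ioc {x y : Set.Icc (0 : ℝ) 1} (hxy : x ≤ y) (c : ℂ) (n : ℤ) :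
    fourierCoeffOn zero_lt_one ((Set.Ioc (x : ℝ) y).indicator fun _ => c) n =
      c * ∫ z in (x : ℝ)..y, fourier (-n) (z : UnitAddCircle) := by
  have hind (z : ℝ) : fourier (-n) (z : UnitAddCircle) *
      (Set.Ioc (x : ℝ) y).indicator (fun _ => c) z =
        (Set.Ioc (x : ℝ) y).indicator (fun z : ℝ => c * fourier (-n) (z : UnitAddCircle)) z := by
    by_cases hz : z ∈ Set.Ioc (x : ℝ) y <;> simp [hz, mul_comm]
  rw [fourierCoeffOn_zero_one]
  simp only [hind]
  rw [intervalIntegral.integral_of_le zero_le_one, integral_indicator measurableSet_Ioc,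
    Measure.restrict_restrict measurableSet_Ioc,
    Set.inter_eq_left.2 (Set.Ioc_subset_Ioc x.2.1 y.2.2), integral_const_mul,
    intervalIntegral.integral_of_le hxy]

lemma fourierCoeffOn_stepFunction {u : ℕ → Set.Icc (0 : ℝ) 1} (hu : Monotone u) (b : ℕ → ℝ)
    (N : ℕ) (n : ℤ) :
    fourierCoeffOn zero_lt_one (stepFunction u b N) n = ∑ j ∈ Finset.range N,
      b j * ∫ z in (u j : ℝ)..u (j + 1), fourier (-n) (z : UnitAddCircle) := by
  have hint (j : ℕ) : IntervalIntegrable (fun z : ℝ => fourier (-n) (z : UnitAddCircle) *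
      (Set.Ioc (u j : ℝ) (u (j + 1))).indicator (fun _ => (b j : ℂ)) z) volume 0 1 := by
    have hconst : IntervalIntegrable ((Set.Ioc (u j : ℝ) (u (j + 1))).indicator
        fun _ => (b j : ℂ)) volume 0 1 := by
      rw [intervalIntegrable_iff_integrableOn_Ioc_of_le zero_le_one]
      exact (integrable_const _).indicator measurableSet_Ioc
    exact hconst.continuousOn_mul
      ((fourier (-n)).continuous.comp (AddCircle.continuous_mk' 1)).continuousOn
  rw [fourierCoeffOn_zero_one]
  simp only [stepFunction, Finset.mul_sum]
  rw [intervalIntegral.integral_finsetSum fun j _ => hint j]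
  refine Finset.sum_congr rfl fun j _ => ?_
  rw [← fourierCoeffOn_zero_one, fourierCoeffOn_indicator_Ioc (hu j.le_succ)]

lemma fourierWeight_incrementWeight (n : ℤ) (x y : Set.Icc (0 : ℝ) 1) :
    fourierWeight n (incrementWeight x y) =
      -2 * Real.pi * Complex.I * n * ∫ z in (x : ℝ)..y, fourier (-n) (z : UnitAddCircle) := by
  have hcont : Continuous fun z : ℝ => -2 * Real.pi * Complex.I * n *
      (fourier (-n) (z : UnitAddCircle) : ℂ) :=
    continuous_const.mul ((fourier (-n)).continuous.comp (AddCircle.continuous_mk' 1))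
  have hderiv (z : ℝ) : HasDerivAt (fun z : ℝ => (fourier (-n) (z : UnitAddCircle) : ℂ))
      (-2 * Real.pi * Complex.I * n * fourier (-n) (z : UnitAddCircle)) z := by
    simpa using hasDerivAt_fourier_neg 1 n z
  rw [fourierWeight, linearCombination_incrementWeight, ← intervalIntegral.integral_const_mul,
    intervalIntegral.integral_eq_sub_of_hasDerivAt (fun z _ => hderiv z)
      (hcont.intervalIntegrable _ _)]

lemma fourierWeight_sum_smul_incrementWeight {u : ℕ → Set.Icc (0 : ℝ) 1} (hu : Monotone u)
    (b : ℕ → ℝ) (N : ℕ) (n : ℤ) :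
    fourierWeight n (∑ j ∈ Finset.range N, b j • incrementWeight (u j) (u (j + 1))) =
      -2 * Real.pi * Complex.I * n * fourierCoeffOn zero_lt_one (stepFunction u b N) n := by
  rw [fourierCoeffOn_stepFunction hu, map_sum, Finset.mul_sum]
  refine Finset.sum_congr rfl fun j _ => ?_
  rw [map_smul, fourierWeight_incrementWeight, Complex.real_smul, mul_left_comm]

theorem lintegral_enorm_sq_duhamelCombination_incrementWeight_le {T : ℝ} (t : Set.Icc (0 : ℝ) T)
    {u : ℕ → Set.Icc (0 : ℝ) 1} (hu : Monotone u) (b : ℕ → ℝ) (N : ℕ) :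
    ∫⁻ p, ‖duhamelCombination t
        (∑ j ∈ Finset.range N, b j • incrementWeight (u j) (u (j + 1))) p‖ₑ ^ 2
          ∂spaceTimeMeasure T ≤
      ENNReal.ofReal (∑ j ∈ Finset.range N, b j ^ 2 * (((u (j + 1) : ℝ) - u j) / 2)) := by
  have hparseval := tsum_enorm_sq_fourierCoeffOn zero_lt_one (memLp_stepFunction 2 u b N)
  simp only [sub_zero, inv_one, ENNReal.ofReal_one, one_mul] at hparseval
  calc ∫⁻ p, ‖duhamelCombination t
        (∑ j ∈ Finset.range N, b j • incrementWeight (u j) (u (j + 1))) p‖ₑ ^ 2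
          ∂spaceTimeMeasure T
      = ∑' n, modeVariance t n * ‖-2 * Real.pi * Complex.I * n‖ₑ ^ 2 *
          ‖fourierCoeffOn zero_lt_one (stepFunction u b N) n‖ₑ ^ 2 := by
        rw [lintegral_enorm_sq_duhamelCombination]
        refine tsum_congr fun n => ?_
        rw [fourierWeight_sum_smul_incrementWeight hu, enorm_mul, mul_pow, ← mul_assoc]
    _ ≤ ∑' n, ENNReal.ofReal (1 / 2) *
          ‖fourierCoeffOn zero_lt_one (stepFunction u b N) n‖ₑ ^ 2 := by
        gcongr with n
        exact modeVariance_mul_enorm_sq_le t.2.1 n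
    _ = ENNReal.ofReal (∑ j ∈ Finset.range N, b j ^ 2 * (((u (j + 1) : ℝ) - u j) / 2)) := by
        rw [ENNReal.tsum_mul_left, hparseval, lintegral_enorm_sq_stepFunction hu,
          ← ENNReal.ofReal_mul (by norm_num), Finset.mul_sum]
        congr 1
        exact Finset.sum_congr rfl fun j _ => by ring

end StepFunction

section CameronMartin

lemma ofReal_apply_le_cameronMartinNorm {E : Type*} [NormedAddCommGroup E] [NormedSpace ℝ E]
    [MeasurableSpace E] {μ : Measure E} (ℓ : StrongDual ℝ E) {v : ℝ} (hv : 0 < v)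
    (hℓ : evariance ℓ μ ≤ ENNReal.ofReal v) (h : E) :
    ENNReal.ofReal (ℓ h) ≤ ENNReal.ofReal √v * cameronMartinNorm μ h := by
  have hsqrt : 0 < √v := Real.sqrt_pos.2 hv
  have hunit : evariance ((√v)⁻¹ • ℓ : StrongDual ℝ E) μ ≤ 1 := by
    calc evariance ((√v)⁻¹ • ℓ : StrongDual ℝ E) μ
        = ENNReal.ofReal ((√v)⁻¹ ^ 2) * evariance ℓ μ := evariance_mul _ ℓ μ
      _ ≤ ENNReal.ofReal ((√v)⁻¹ ^ 2) * ENNReal.ofReal v := by gcongr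
      _ = 1 := by
          rw [inv_pow, Real.sq_sqrt hv.le, ← ENNReal.ofReal_mul (by positivity),
            inv_mul_cancel₀ hv.ne', ENNReal.ofReal_one]
  calc ENNReal.ofReal (ℓ h)
      = ENNReal.ofReal √v * ENNReal.ofReal (((√v)⁻¹ • ℓ : StrongDual ℝ E) h) := by
        rw [← ENNReal.ofReal_mul hsqrt.le, _root_.smul_apply, smul_eq_mul,
          mul_inv_cancel_left₀ hsqrt.ne']
    _ ≤ ENNReal.ofReal √v * cameronMartinNorm μ h := by
        gcongr
        exact le_iSup₂_of_le ((√v)⁻¹ • ℓ : StrongDual ℝ E) hunit le_rfl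

end CameronMartin

namespace SheetSpace

variable {T α β m : ℝ} [Fact (0 < T)] [Fact (1 ≤ m)] {d : ℕ}

/-- The continuous functional `f ↦ f^i(t, x)` on the sheet space. -/
def evalCLM (hα : 1 / m < α) (hβ : 1 / m < β) (t : Set.Icc (0 : ℝ) T) (i : Fin d)
    (x : Set.Icc (0 : ℝ) 1) : StrongDual ℝ (SheetSpace T α β m d) :=
  (EuclideanSpace.proj i).comp ((BesovPath.evalCLM hα x).comp ((BesovPath.evalCLM hβ t).comp
    (BesovPath.startZero T β m (BesovPath 1 α m (EuclideanSpace ℝ (Fin d)))).subtypeL))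

/-- The continuous functional `f ↦ ∑ᵢ ∑ₓ aⁱₓ f^i(t, x)` on the sheet space. -/
def combination (hα : 1 / m < α) (hβ : 1 / m < β) (t : Set.Icc (0 : ℝ) T)
    (a : Fin d → Set.Icc (0 : ℝ) 1 →₀ ℝ) : StrongDual ℝ (SheetSpace T α β m d) :=
  ∑ i, Finsupp.linearCombination ℝ (evalCLM hα hβ t i) (a i)

lemma combination_apply (hα : 1 / m < α) (hβ : 1 / m < β) (t : Set.Icc (0 : ℝ) T)
    (a : Fin d → Set.Icc (0 : ℝ) 1 →₀ ℝ) (f : SheetSpace T α β m d) :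
    combination hα hβ t a f =
      ∑ i, Finsupp.linearCombination ℝ (fun x => f.slice t x i) (a i) := by
  rw [combination, _root_.sum_apply]
  refine Finset.sum_congr rfl fun i _ => ?_
  rw [Finsupp.linearCombination_apply, Finsupp.linearCombination_apply, Finsupp.sum, Finsupp.sum,
    _root_.sum_apply]
  rfl

lemma combination_sum_smul_apply (hα : 1 / m < α) (hβ : 1 / m < β) (t : Set.Icc (0 : ℝ) T)
    {ι : Type*} (s : Finset ι) (e : ι → EuclideanSpace ℝ (Fin d))
    (a : ι → Set.Icc (0 : ℝ) 1 →₀ ℝ) (f : SheetSpace T α β m d) :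
    combination hα hβ t (fun i => ∑ j ∈ s, e j i • a j) f =
      ∑ j ∈ s, inner ℝ (e j) (Finsupp.linearCombination ℝ (f.slice t) (a j)) := by
  have hproj (i : Fin d) (b : Set.Icc (0 : ℝ) 1 →₀ ℝ) :
      Finsupp.linearCombination ℝ (fun x => f.slice t x i) b =
        Finsupp.linearCombination ℝ (f.slice t) b i :=
    (Finsupp.apply_linearCombination ℝ
      (EuclideanSpace.proj i : StrongDual ℝ (EuclideanSpace ℝ (Fin d))).toLinearMap (f.slice t)
      b).symm
  simp only [combination_apply, map_sum, map_smul, PiLp.inner_apply, ← hproj, smul_eq_mul]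
  rw [Finset.sum_comm]
  exact Finset.sum_congr rfl fun j _ => Finset.sum_congr rfl fun i _ => mul_comm _ _

end SheetSpace

lemma ofReal_norm_toLp_sq {X : Type*} [MeasurableSpace X] {μ : Measure X} {f : X → ℝ}
    (hf : MemLp f 2 μ) : ENNReal.ofReal (‖hf.toLp f‖ ^ 2) = ∫⁻ x, ‖f x‖ₑ ^ 2 ∂μ := by
  rw [ENNReal.ofReal_pow (norm_nonneg _), Lp.norm_toLp, ENNReal.ofReal_toReal hf.2.ne]
  simpa using eLpNorm_nnreal_pow_eq_lintegral (p := 2) (f := f) (μ := μ) two_ne_zero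

lemma IsWhiteNoise.variance_eq {Ω : Type*} [MeasurableSpace Ω] {T : ℝ} {P : Measure Ω}
    {ξ : Lp ℝ 2 (spaceTimeMeasure T) →ₗ[ℝ] Lp ℝ 2 P} (hξ : IsWhiteNoise T P ξ)
    (f : Lp ℝ 2 (spaceTimeMeasure T)) : Var[ξ f; P] = ‖f‖ ^ 2 := by
  rw [(hξ f).variance_eq, variance_id_gaussianReal]
  simp

namespace IsStochasticHeatSheet

variable {Ω : Type*} [MeasurableSpace Ω] {T α β m : ℝ} [Fact (0 < T)]
  [Fact (1 ≤ m)] {d : ℕ} {P : Measure Ω}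
  {ξ : Fin d → Lp ℝ 2 (spaceTimeMeasure T) →ₗ[ℝ] Lp ℝ 2 P}
  {ψ : Ω → SheetSpace T α β m d}

lemma memLp_duhamelCombination (hψ : IsStochasticHeatSheet P ξ ψ) (i : Fin d)
    (t : Set.Icc (0 : ℝ) T) (a : Set.Icc (0 : ℝ) 1 →₀ ℝ) :
    MemLp (duhamelCombination t a) 2 (spaceTimeMeasure T) := by
  induction a using Finsupp.induction_linear with
  | zero => simp
  | add a b ha hb =>
    rw [map_add]
    exact ha.add hb
  | single x r =>
    obtain ⟨hK, -⟩ := hψ.mild t x i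
    rw [duhamelCombination, Finsupp.linearCombination_single]
    exact hK.const_smul r

lemma linearCombination_slice_ae_eq (hψ : IsStochasticHeatSheet P ξ ψ) (i : Fin d)
    (t : Set.Icc (0 : ℝ) T) (a : Set.Icc (0 : ℝ) 1 →₀ ℝ) :
    (fun ω => Finsupp.linearCombination ℝ (fun x => (ψ ω).slice t x i) a) =ᵐ[P]
      ξ i ((hψ.memLp_duhamelCombination i t a).toLp _) := by
  induction a using Finsupp.induction_linear with
  | zero =>
    have hzero : (hψ.memLp_duhamelCombination i t 0).toLp _ = 0 := by
      simp only [map_zero]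
      exact MemLp.toLp_zero _
    rw [hzero, map_zero]
    simp only [map_zero]
    exact (Lp.coeFn_zero ℝ 2 P).symm
  | add a b ha hb =>
    have hadd : (hψ.memLp_duhamelCombination i t (a + b)).toLp _ =
        (hψ.memLp_duhamelCombination i t a).toLp _ +
          (hψ.memLp_duhamelCombination i t b).toLp _ := by
      simp only [map_add]
      exact MemLp.toLp_add _ _
    rw [hadd, map_add]
    simp only [map_add]
    exact (ha.add hb).trans (Lp.coeFn_add _ _).symm
  | single x r =>
    obtain ⟨hK, hx⟩ := hψ.mild t x i
    have hsmul : (hψ.memLp_duhamelCombination i t (Finsupp.single x r)).toLp _ =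
        r • hK.toLp _ := by
      simp only [duhamelCombination, Finsupp.linearCombination_single]
      exact MemLp.toLp_const_smul _ _
    rw [hsmul, map_smul]
    simp only [Finsupp.linearCombination_single]
    exact (hx.const_smul r).trans (Lp.coeFn_smul _ _).symm

lemma combination_comp_ae_eq (hψ : IsStochasticHeatSheet P ξ ψ) (hα : 1 / m < α) (hβ : 1 / m < β)
    (t : Set.Icc (0 : ℝ) T) (a : Fin d → Set.Icc (0 : ℝ) 1 →₀ ℝ) :
    SheetSpace.combination hα hβ t a ∘ ψ =ᵐ[P]
      ∑ i, ⇑(ξ i ((hψ.memLp_duhamelCombination i t (a i)).toLp _)) := by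
  filter_upwards [ae_all_iff.2 fun i => hψ.linearCombination_slice_ae_eq i t (a i)] with ω hω
  rw [Function.comp_apply, SheetSpace.combination_apply, Finset.sum_apply]
  exact Finset.sum_congr rfl fun i _ => hω i

theorem evariance_combination [IsProbabilityMeasure P] (hψ : IsStochasticHeatSheet P ξ ψ)
    (hα : 1 / m < α) (hβ : 1 / m < β) (t : Set.Icc (0 : ℝ) T)
    (a : Fin d → Set.Icc (0 : ℝ) 1 →₀ ℝ) :
    evariance (SheetSpace.combination hα hβ t a) (P.map ψ) =
      ∑ i, ∫⁻ p, ‖duhamelCombination t (a i) p‖ₑ ^ 2 ∂spaceTimeMeasure T := by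
  set ℓ := SheetSpace.combination (d := d) hα hβ t a
  have hℓ : AEStronglyMeasurable ℓ (P.map ψ) := ℓ.continuous.measurable.aestronglyMeasurable
  have hae := hψ.combination_comp_ae_eq hα hβ t a
  have hmem : MemLp (ℓ ∘ ψ) 2 P :=
    (memLp_congr_ae hae).2 (memLp_finsetSum' _ fun i _ => Lp.memLp _)
  have hindep : iIndepFun
      (fun i => ⇑(ξ i ((hψ.memLp_duhamelCombination i t (a i)).toLp _))) P :=
    hψ.indep.comp (fun _ F => F _) fun i => measurable_pi_apply _
  have : IsProbabilityMeasure (P.map ψ) := Measure.isProbabilityMeasure_map hψ.aemeasurable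
  rw [← ofReal_variance ((memLp_map_measure_iff hℓ hψ.aemeasurable).2 hmem),
    variance_map hℓ.aemeasurable hψ.aemeasurable, variance_congr hae,
    IndepFun.variance_sum (fun i _ => Lp.memLp _) fun i _ j _ hij => hindep.indepFun hij,
    ENNReal.ofReal_sum_of_nonneg fun i _ => variance_nonneg _ _]
  refine Finset.sum_congr rfl fun i _ => ?_
  rw [(hψ.isWhiteNoise i).variance_eq, ofReal_norm_toLp_sq]

section Duality

variable [IsProbabilityMeasure P] (hψ : IsStochasticHeatSheet P ξ ψ) (hα : 1 / m < α)
  (hβ : 1 / m < β) (t : Set.Icc (0 : ℝ) T)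

include hψ

lemma evariance_combination_sum_smul_le {ι : Type*} {s : Finset ι}
    {a : ι → Set.Icc (0 : ℝ) 1 →₀ ℝ} {κ : ι → ℝ} (hκ : ∀ j ∈ s, 0 ≤ κ j)
    (hvar : ∀ b : ι → ℝ, ∫⁻ p, ‖duhamelCombination t (∑ j ∈ s, b j • a j) p‖ₑ ^ 2
      ∂spaceTimeMeasure T ≤ ENNReal.ofReal (∑ j ∈ s, b j ^ 2 * κ j))
    {e : ι → EuclideanSpace ℝ (Fin d)} (he : ∀ j ∈ s, ‖e j‖ ≤ 1) :
    evariance (SheetSpace.combination hα hβ t fun i => ∑ j ∈ s, e j i • a j) (P.map ψ) ≤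
      ENNReal.ofReal (∑ j ∈ s, κ j) := by
  rw [hψ.evariance_combination]
  calc ∑ i, ∫⁻ p, ‖duhamelCombination t (∑ j ∈ s, e j i • a j) p‖ₑ ^ 2 ∂spaceTimeMeasure T
      ≤ ∑ i, ENNReal.ofReal (∑ j ∈ s, e j i ^ 2 * κ j) := by
        gcongr with i
        exact hvar fun j => e j i
    _ = ENNReal.ofReal (∑ j ∈ s, ‖e j‖ ^ 2 * κ j) := by
        rw [← ENNReal.ofReal_sum_of_nonneg fun i _ => Finset.sum_nonneg fun j hj =>
          mul_nonneg (sq_nonneg _) (hκ j hj), Finset.sum_comm]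
        simp only [EuclideanSpace.real_norm_sq_eq, Finset.sum_mul]
    _ ≤ ENNReal.ofReal (∑ j ∈ s, κ j) := by
        gcongr with j hj
        exact mul_le_of_le_one_left (hκ j hj) (pow_le_one₀ (norm_nonneg _) (he j hj))

include hα hβ

theorem sum_enorm_linearCombination_slice_le {ι : Type*} {s : Finset ι}
    {a : ι → Set.Icc (0 : ℝ) 1 →₀ ℝ} {κ : ι → ℝ} (hκ : ∀ j ∈ s, 0 ≤ κ j)
    (hvar : ∀ b : ι → ℝ, ∫⁻ p, ‖duhamelCombination t (∑ j ∈ s, b j • a j) p‖ₑ ^ 2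
      ∂spaceTimeMeasure T ≤ ENNReal.ofReal (∑ j ∈ s, b j ^ 2 * κ j))
    {v : ℝ} (hv : 0 < v) (hκv : ∑ j ∈ s, κ j ≤ v) (h : SheetSpace T α β m d) :
    ∑ j ∈ s, ‖Finsupp.linearCombination ℝ (h.slice t) (a j)‖ₑ ≤
      ENNReal.ofReal √v * cameronMartinNorm (P.map ψ) h := by
  set w : ι → EuclideanSpace ℝ (Fin d) :=
    fun j => Finsupp.linearCombination ℝ (h.slice t) (a j)
  have hdirection (j : ι) : ‖‖w j‖⁻¹ • w j‖ ≤ 1 := by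
    rw [norm_smul, norm_inv, norm_norm]
    exact inv_mul_le_one
  have hinner (j : ι) : inner ℝ (‖w j‖⁻¹ • w j) (w j) = ‖w j‖ := by
    rw [real_inner_smul_left, real_inner_self_eq_norm_mul_norm, ← mul_assoc, inv_mul_mul_self]
  have hvariance := (hψ.evariance_combination_sum_smul_le hα hβ t hκ hvar
    fun j _ => hdirection j).trans (ENNReal.ofReal_le_ofReal hκv)
  have hdual := ofReal_apply_le_cameronMartinNorm _ hv hvariance h
  rw [SheetSpace.combination_sum_smul_apply] at hdual
  simp only [w] at hinner
  simp only [w, hinner] at hdual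
  rw [ENNReal.ofReal_sum_of_nonneg fun j _ => norm_nonneg _] at hdual
  simpa only [ofReal_norm] using hdual

theorem enorm_slice_le (x : Set.Icc (0 : ℝ) 1) (h : SheetSpace T α β m d) :
    ‖h.slice t x‖ₑ ≤ ENNReal.ofReal √(T + 1 / 24) * cameronMartinNorm (P.map ψ) h := by
  have hT : 0 < T + 1 / 24 := add_pos (Fact.out : 0 < T) (by norm_num)
  simpa using hψ.sum_enorm_linearCombination_slice_le hα hβ t (s := {()})
    (a := fun _ => Finsupp.single x 1) (κ := fun _ => T + 1 / 24) (fun _ _ => hT.le)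
    (fun b => by simpa using lintegral_enorm_sq_duhamelCombination_single_le t x (b ())) hT
    (by simp) h

theorem eVariationOn_slice_Icc_le {x y : Set.Icc (0 : ℝ) 1} (hxy : x < y)
    (h : SheetSpace T α β m d) :
    eVariationOn (h.slice t) (Set.Icc x y) ≤
      ENNReal.ofReal √((y - x) / 2) * cameronMartinNorm (P.map ψ) h := by
  refine iSup_le fun ⟨N, u, hu, hmem⟩ => ?_
  have hlength : ∑ j ∈ Finset.range N, ((u (j + 1) : ℝ) - u j) / 2 ≤ (y - x) / 2 := by
    rw [← Finset.sum_div, Finset.sum_range_sub fun j => (u j : ℝ)]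
    have hlast : (u N : ℝ) ≤ y := (hmem N).2
    have hfirst : (x : ℝ) ≤ u 0 := (hmem 0).1
    linarith
  have hincr (j : ℕ) : 0 ≤ ((u (j + 1) : ℝ) - u j) / 2 :=
    div_nonneg (sub_nonneg.2 (hu j.le_succ)) two_pos.le
  have hpos : 0 < ((y : ℝ) - x) / 2 := half_pos (sub_pos.2 hxy)
  have hsum := hψ.sum_enorm_linearCombination_slice_le hα hβ t
    (a := fun j => incrementWeight (u j) (u (j + 1))) (fun j _ => hincr j)
    (fun b => lintegral_enorm_sq_duhamelCombination_incrementWeight_le t hu b N) hpos hlength h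
  simpa only [linearCombination_incrementWeight, edist_eq_enorm_sub] using hsum

end Duality

end IsStochasticHeatSheet

section PathNorms

variable {V : Type*} [NormedAddCommGroup V]

lemma sum_rpow_rpow_one_div_le_sum {q : ℝ} (hq : 1 ≤ q) {ι : Type*} (s : Finset ι)
    (f : ι → ℝ≥0∞) : (∑ i ∈ s, f i ^ q) ^ (1 / q) ≤ ∑ i ∈ s, f i := by
  classical
  have hq0 : 0 < q := zero_lt_one.trans_le hq
  induction s using Finset.induction_on with
  | empty => simp [hq0]
  | insert i s hi ih =>
    rw [Finset.sum_insert hi, Finset.sum_insert hi]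
    calc (f i ^ q + ∑ j ∈ s, f j ^ q) ^ (1 / q)
        = (f i ^ q + ((∑ j ∈ s, f j ^ q) ^ (1 / q)) ^ q) ^ (1 / q) := by
          rw [← ENNReal.rpow_mul, one_div_mul_cancel hq0.ne', ENNReal.rpow_one]
      _ ≤ f i + (∑ j ∈ s, f j ^ q) ^ (1 / q) := ENNReal.rpow_add_rpow_le_add _ _ hq
      _ ≤ f i + ∑ j ∈ s, f j := by gcongr

lemma variationNorm_le_eVariationOn {q : ℝ} (hq : 1 ≤ q) (f : Set.Icc (0 : ℝ) 1 → V) :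
    variationNorm q f ≤ eVariationOn f Set.univ := by
  have hq0 : 0 < q := zero_lt_one.trans_le hq
  rw [variationNorm, one_div, ENNReal.rpow_inv_le_iff hq0]
  refine iSup_le fun p => ?_
  rw [← ENNReal.rpow_inv_le_iff hq0, ← one_div]
  refine (sum_rpow_rpow_one_div_le_sum hq _ _).trans ?_
  simpa only [edist_eq_enorm_sub] using
    eVariationOn.sum_le (f := f) (s := Set.univ) (n := p.1) p.2.2 fun _ => Set.mem_univ _

lemma holderNorm_le {γ : ℝ} {f : Set.Icc (0 : ℝ) 1 → V} {A B : ℝ≥0∞} (hzero : ‖f 0‖ₑ ≤ A)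
    (hincr : ∀ x y : Set.Icc (0 : ℝ) 1, x < y →
      edist (f x) (f y) ≤ B * ENNReal.ofReal (((y : ℝ) - x) ^ γ)) :
    holderNorm γ f ≤ A + B := by
  refine add_le_add hzero (iSup_le fun x => iSup_le fun y => iSup_le fun hxy => ?_)
  refine ENNReal.div_le_of_le_mul ?_
  rw [← edist_eq_enorm_sub, edist_comm, abs_of_pos (sub_pos.2 (Subtype.coe_lt_coe.2 hxy))]
  exact hincr x y hxy

end PathNorms

namespace IsStochasticHeatSheet

variable {Ω : Type*} [MeasurableSpace Ω] {T α β m : ℝ} [Fact (0 < T)]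
  [Fact (1 ≤ m)] {d : ℕ} {P : Measure Ω} [IsProbabilityMeasure P]
  {ξ : Fin d → Lp ℝ 2 (spaceTimeMeasure T) →ₗ[ℝ] Lp ℝ 2 P}
  {ψ : Ω → SheetSpace T α β m d}

theorem holderNorm_slice_le (hψ : IsStochasticHeatSheet P ξ ψ) (hα : 1 / m < α) (hβ : 1 / m < β)
    (t : Set.Icc (0 : ℝ) T) (h : SheetSpace T α β m d) :
    holderNorm (1 / 2) (h.slice t) ≤
      ENNReal.ofReal (√(T + 1 / 24) + √(1 / 2)) * cameronMartinNorm (P.map ψ) h := by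
  rw [ENNReal.ofReal_add (Real.sqrt_nonneg _) (Real.sqrt_nonneg _), add_mul]
  refine holderNorm_le (hψ.enorm_slice_le hα hβ t 0 h) fun x y hxy => ?_
  calc edist (h.slice t x) (h.slice t y)
      ≤ eVariationOn (h.slice t) (Set.Icc x y) :=
        eVariationOn.edist_le _ (Set.left_mem_Icc.2 hxy.le) (Set.right_mem_Icc.2 hxy.le)
    _ ≤ ENNReal.ofReal √((y - x) / 2) * cameronMartinNorm (P.map ψ) h :=
        hψ.eVariationOn_slice_Icc_le hα hβ t hxy h
    _ = ENNReal.ofReal √(1 / 2) * cameronMartinNorm (P.map ψ) h *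
          ENNReal.ofReal (((y : ℝ) - x) ^ (1 / 2 : ℝ)) := by
        rw [mul_right_comm, ← ENNReal.ofReal_mul (Real.sqrt_nonneg _), ← Real.sqrt_eq_rpow,
          ← Real.sqrt_mul (by norm_num), one_div_mul_eq_div]

theorem variationNorm_slice_le (hψ : IsStochasticHeatSheet P ξ ψ) (hα : 1 / m < α)
    (hβ : 1 / m < β) (t : Set.Icc (0 : ℝ) T) (h : SheetSpace T α β m d) {q : ℝ} (hq : 1 ≤ q) :
    variationNorm q (h.slice t) ≤
      ENNReal.ofReal √(1 / 2) * cameronMartinNorm (P.map ψ) h := by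
  have huniv : (Set.univ : Set (Set.Icc (0 : ℝ) 1)) = Set.Icc 0 1 := Set.Icc_bot_top.symm
  calc variationNorm q (h.slice t)
      ≤ eVariationOn (h.slice t) (Set.Icc 0 1) := huniv ▸ variationNorm_le_eVariationOn hq _
    _ ≤ ENNReal.ofReal √(1 / 2) * cameronMartinNorm (P.map ψ) h := by
        simpa using hψ.eVariationOn_slice_Icc_le hα hβ t zero_lt_one h

end IsStochasticHeatSheet

end

theorem mainTheorem9_general (T : ℝ) [Fact (0 < T)] (d : ℕ) (α β m : ℝ) [Fact (1 ≤ m)]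
    (hα : 1 / m < α) (hβ : 1 / m < β) {Ω : Type*} [MeasurableSpace Ω] (P : Measure Ω)
    [IsProbabilityMeasure P] (ξ : Fin d → Lp ℝ 2 (spaceTimeMeasure T) →ₗ[ℝ] Lp ℝ 2 P)
    (ψ : Ω → SheetSpace T α β m d) (hψ : IsStochasticHeatSheet P ξ ψ)
    (h : SheetSpace T α β m d) (hh : h ∈ cameronMartinSpace (P.map ψ)) (t : Set.Icc (0 : ℝ) T) :
    (holderNorm (1 / 2) (h.slice t) < ⊤ ∧
      holderNorm (1 / 2) (h.slice t) ≤
        ENNReal.ofReal (√(T + 1 / 24) + √(1 / 2)) * cameronMartinNorm (P.map ψ) h) ∧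
    ∀ q : ℝ, 1 ≤ q →
      variationNorm q (h.slice t) < ⊤ ∧
        variationNorm q (h.slice t) ≤
          ENNReal.ofReal √(1 / 2) * cameronMartinNorm (P.map ψ) h := by
  have hfinite (c : ℝ) : ENNReal.ofReal c * cameronMartinNorm (P.map ψ) h < ⊤ :=
    ENNReal.mul_lt_top ENNReal.ofReal_lt_top hh
  have hholder := hψ.holderNorm_slice_le hα hβ t h
  have hvariation {q : ℝ} (hq : 1 ≤ q) := hψ.variationNorm_slice_le hα hβ t h hq
  exact ⟨⟨hholder.trans_lt (hfinite _), hholder⟩,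
    fun q hq => ⟨(hvariation hq).trans_lt (hfinite _), hvariation hq⟩⟩

theorem mainTheorem9 (T : ℝ) [Fact (0 < T)] :
    ∃ (c : ℝ) (C : ℝ → ℝ), 0 < c ∧ (∀ q, 0 < C q) ∧
      ∀ (d : ℕ) (α β m : ℝ) [Fact (1 ≤ m)],
        1 / 3 < α → α < 1 / 2 → 0 < β → 1 / 3 < α - 1 / m → 1 / m < β → 4 * β < 1 - 2 * α →
        ∀ {Ω : Type*} [MeasurableSpace Ω] (P : Measure Ω) [IsProbabilityMeasure P]
          (ξ : Fin d → Lp ℝ 2 (spaceTimeMeasure T) →ₗ[ℝ] Lp ℝ 2 P)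
          (ψ : Ω → SheetSpace T α β m d), IsStochasticHeatSheet P ξ ψ →
          ∀ h ∈ cameronMartinSpace (P.map ψ), ∀ t : Set.Icc (0 : ℝ) T,
            (holderNorm (1 / 2) (h.slice t) < ⊤ ∧
              holderNorm (1 / 2) (h.slice t) ≤
                ENNReal.ofReal c * cameronMartinNorm (P.map ψ) h) ∧
            ∀ q : ℝ, 4 / 3 < q → q < 2 →
              variationNorm q (h.slice t) < ⊤ ∧
                variationNorm q (h.slice t) ≤
                  ENNReal.ofReal (C q) * cameronMartinNorm (P.map ψ) h := by
  have hT : 0 < T := Fact.out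
  refine ⟨√(T + 1 / 24) + √(1 / 2), fun _ => √(1 / 2), by positivity, fun _ => by positivity, ?_⟩
  intro d α β m _ _ _ _ hα hβ _ Ω _ P _ ξ ψ hψ h hh t
  exact (mainTheorem9_general T d α β m (by linarith) hβ P ξ ψ hψ h hh t).imp_right
    fun hvariation q hq _ => hvariation q (by linarith)
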